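/- All graphs are finite and simple. A \emph{plane drawing} of a graph represents its vertices by distinct points of the plane and each edge by a simple (continuous, injective) arc joining the points of its two ends, such that an edge contains no vertex other than its ends and two different edges meet only at vertices. The \emph{faces} of a drawing are the connected components of the complement of the drawing in the plane (the unbounded one included). A graph $G$ is \emph{maximal planar} if it has a plane drawing in which every face is enclosed by three edges, that is, the boundary of every face is the union of the arcs $xy$, $yz$, $zx$ of three pairwise adjacent vertices $x,y,z$ of $G$. Two vertices are \emph{alike} if they have the same set of neighbors. For $n\ge 3$, the \emph{bipyramid} over an $n$-cycle is the graph with vertex set $\{a_1,a_2\}\cup\{b_1,\dots,b_n\}$ and edge set $$\{a_ib_j : i\in\{1,2\},\ 1\le j\le n\}\cup\{b_jb_{j+1} : 1\le j\le n\},\qquad b_{n+1}=b_1.$$ \textbf{Lemma.} Let $G$ be a maximal planar graph and let $a\ne b$ be two vertices of $G$ that are alike. Then $G$ is a bipyramid with apexes $a$ and $b$ whose cycle consists of their common neighbors: for some $n\ge 3$ there is a graph isomorphism from the bipyramid over an $n$-cycle onto $G$ that sends $a_1$ to $a$, $a_2$ to $b$, and $\{b_1,\dots,b_n\}$ onto the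 set of common neighbors of $a$ and $b$. -/

import Mathlib

/-- `A` is a simple arc in the plane with end points `p` and `q`: the image of an injective
continuous path from `p` to `q`. The plane is taken to be `ℂ`. -/
def IsPlaneArc (A : Set ℂ) (p q : ℂ) : Prop :=
  ∃ γ : unitInterval → ℂ, Continuous γ ∧ Function.Injective γ ∧
    γ 0 = p ∧ γ 1 = q ∧ Set.range γ = A

/-- A drawing of the simple graph `G` in the plane in which no two edges intersect except at the
vertices: vertices are distinct points, the edge `xy` is a simple arc from `x` to `y`, an edge
contains no vertex except its own ends, and any common point of two different edges is a vertex. -/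
structure PlaneDrawing {V : Type*} (G : SimpleGraph V) where
  /-- the point that represents a vertex -/
  point : V → ℂ
  /-- the arc that represents an edge -/
  arc : G.edgeSet → Set ℂ
  point_injective : Function.Injective point
  isPlaneArc : ∀ (x y : V) (h : G.Adj x y), IsPlaneArc (arc ⟨s(x, y), h⟩) (point x) (point y)
  mem_of_point_mem_arc : ∀ (e : G.edgeSet) (v : V), point v ∈ arc e → v ∈ (e : Sym2 V)
  arc_inter_arc : ∀ e f : G.edgeSet, e ≠ f → arc e ∩ arc f ⊆ Set.range point

namespace PlaneDrawing

/-- The set of all points of the plane that are covered by the drawing. -/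
def carrier {V : Type*} {G : SimpleGraph V} (D : PlaneDrawing G) : Set ℂ :=
  Set.range D.point ∪ ⋃ e, D.arc e

/-- The faces of a drawing (the unbounded one included): the connected components of the
complement of the drawing. -/
def IsFace {V : Type*} {G : SimpleGraph V} (D : PlaneDrawing G) (F : Set ℂ) : Prop :=
  ∃ z ∈ D.carrierᶜ, F = connectedComponentIn D.carrierᶜ z

/-- The set `F` is enclosed by three edges: its boundary is the drawing of a triangle of `G`. -/
def IsEnclosedByThreeEdges {V : Type*} {G : SimpleGraph V} (D : PlaneDrawing G)
    (F : Set ℂ) : Prop :=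
  ∃ (x y z : V) (hxy : G.Adj x y) (hyz : G.Adj y z) (hzx : G.Adj z x),
    frontier F = D.arc ⟨s(x, y), hxy⟩ ∪ D.arc ⟨s(y, z), hyz⟩ ∪ D.arc ⟨s(z, x), hzx⟩

end PlaneDrawing

/-- A graph is maximal planar if it can be drawn in the plane, without crossings, such that every
face (the unbounded one included) is enclosed by three edges. -/
def IsMaximalPlanar {V : Type*} (G : SimpleGraph V) : Prop :=
  ∃ D : PlaneDrawing G, ∀ F : Set ℂ, D.IsFace F → D.IsEnclosedByThreeEdges F

/-- Two vertices are alike if they have the same neighbors. -/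
def Alike {V : Type*} (G : SimpleGraph V) (a b : V) : Prop :=
  G.neighborSet a = G.neighborSet b

/-- The bipyramid over a cycle of length `n` (meaningful for `n ≥ 3`): the apexes are
`Sum.inl 0` and `Sum.inl 1`, the vertices of the cycle are `Sum.inr j`; each apex is joined to each
vertex of the cycle, and the vertices of the cycle are joined cyclically. -/
def bipyramid (n : ℕ) : SimpleGraph (Fin 2 ⊕ Fin n) where
  Adj u v :=
    match u, v with
    | Sum.inl _, Sum.inl _ => False
    | Sum.inl _, Sum.inr _ => True
    | Sum.inr _, Sum.inl _ => True
    | Sum.inr i, Sum.inr j => (SimpleGraph.cycleGraph n).Adj i j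
  symm := ⟨by
    rintro (i | i) (j | j) h
    · exact h
    · trivial
    · trivial
    · exact SimpleGraph.Adj.symm h⟩
  loopless := ⟨by
    rintro (i | i) h
    · exact h
    · exact SimpleGraph.irrefl _ h⟩

/-!
Let `N` be the common neighborhood of the alike vertices `a` and `b`, in a drawing all of whose
faces are enclosed by triangles.

If `x` and `y` are adjacent vertices of `N`, then the side of the triangle `a x y` away from `b` is
a face (`PlaneDrawing.exists_isFace_frontier_eq_tri`): a face inside it along the edge `a x` is
enclosed by a triangle `a x t` with `t` in `N`, and for `t ≠ y` the edge `b t` would have to cross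
the triangle `a x y`. By symmetry `b x y` bounds a face too. Every edge is on the boundary of
exactly two faces. Hence those two are the only faces at the edge `x y`
(`PlaneDrawing.eq_or_eq_of_frontier_eq_tri`), and in the graph induced on `N` all degrees are 0 or
2 (`PlaneDrawing.ncard_adj_eq_two`). Some edge `x y` lies in `N` because `a` is on the boundary of
a face. Take the connected component of `x` in the graph induced on `N`. The closed faces `a x' y'`
and `b x' y'`, for the edges `x' y'` of that component, form a set that is open and closed away
from the finitely many vertices. It is therefore the whole plane
(`PlaneDrawing.eq_or_eq_or_mem_of_closed`). So `a`, `b` and the component contain all vertices, and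
the component is a cycle.

The topology of the plane needed for this comes from Eilenberg's criterion: points `p` and `q`
outside a compact set `K` are in the same component of its complement if and only if
`(z - p) / (z - q)` has a continuous logarithm on `K`. One direction lifts a homotopy through the
covering `Complex.exp`; the other uses that `z - p` has no logarithm on a circle around `p`. In the
more general form `exponents_eq_zero`, the criterion shows that arcs do not separate the plane
(`HasLogs.mem_connectedComponentIn`) and that adding an arc splits a component into at most two
(`mem_connectedComponentIn_union_arc`). That a triangle does separate the plane is obtained by
gluing logarithms over the complements of its parts (`not_isPreconnected_compl_union`).
-/

/-! ### Continuous logarithms -/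

/-- Every continuous function without zeros on `K` has a continuous logarithm on `K`. -/
def HasLogs (K : Set ℂ) : Prop :=
  ∀ f : ℂ → ℂ, ContinuousOn f K → (∀ z ∈ K, f z ≠ 0) →
    ∃ g : ℂ → ℂ, ContinuousOn g K ∧ ∀ z ∈ K, f z = Complex.exp (g z)

/-- The function `z ↦ (z - p) / (z - q)` has a continuous logarithm on `S`; the equation is
written without division. -/
def LogRel (S : Set ℂ) (p q : ℂ) : Prop :=
  ∃ g : ℂ → ℂ, ContinuousOn g S ∧ ∀ z ∈ S, z - p = (z - q) * Complex.exp (g z)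

theorem eqOn_of_exp_eqOn {X : Type*} [TopologicalSpace X] {S : Set X} (hS : IsPreconnected S)
    {g h : X → ℂ} (hg : ContinuousOn g S) (hh : ContinuousOn h S)
    (he : ∀ z ∈ S, Complex.exp (g z) = Complex.exp (h z)) {x : X} (hx : x ∈ S)
    (hxe : g x = h x) : Set.EqOn g h S :=
  Complex.isCoveringMap_exp.eqOn_of_comp_eqOn hS hg hh
    (fun z hz => Subtype.ext (he z hz)) hx hxe

theorem HasLogs.ball (c : ℂ) {r : ℝ} (hr : 0 < r) : HasLogs (Metric.ball c r) := by
  intro f hf h0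
  have hsc : IsSimplyConnected (Metric.ball c r) := by
    have := Metric.contractibleSpace_ball (x := c) hr
    exact SimplyConnectedSpace.ofContractible _
  obtain ⟨g, hg, h⟩ := Complex.exists_continuousOn_eqOn_exp_comp
    hsc Metric.isOpen_ball hf (by rintro ⟨z, hz, h⟩; exact h0 z hz h)
  exact ⟨g, hg, fun z hz => (h hz).symm⟩

theorem IsPlaneArc.hasLogs {A : Set ℂ} {p q : ℂ} (hA : IsPlaneArc A p q) : HasLogs A := by
  obtain ⟨γ, hγ, hinj, -, -, rfl⟩ := hA
  intro f hf h0
  have hemb : Topology.IsClosedEmbedding γ := hγ.isClosedEmbedding hinj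
  let F : ℝ → ℂ := Set.IccExtend zero_le_one (f ∘ γ)
  have hF : Continuous F :=
    (hf.comp_continuous hγ fun t => Set.mem_range_self t).Icc_extend' 
  have hsc : IsSimplyConnected (Set.univ : Set ℝ) := by
    have := (convex_univ : Convex ℝ (Set.univ : Set ℝ)).contractibleSpace ⟨0, trivial⟩
    exact SimplyConnectedSpace.ofContractible _
  obtain ⟨G, hG, h⟩ := Complex.exists_continuousOn_eqOn_exp_comp hsc isOpen_univ hF.continuousOn
    (by rintro ⟨z, -, h⟩; exact h0 _ (Set.mem_range_self _) h)
  let e := hemb.isEmbedding.toHomeomorph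
  classical
  refine ⟨fun z => if hz : z ∈ Set.range γ then G (e.symm ⟨z, hz⟩) else 0, ?_, ?_⟩
  · rw [continuousOn_iff_continuous_domRestrict]
    have : Continuous fun z : Set.range γ => G (e.symm z) :=
      (continuousOn_univ.1 hG).comp (continuous_subtype_val.comp e.symm.continuous)
    exact this.congr fun z => by rw [Set.domRestrict_apply, dif_pos z.2]
  · rintro _ ⟨t, rfl⟩
    have : e.symm ⟨γ t, t, rfl⟩ = t := e.symm_apply_eq.2 (Subtype.ext rfl)
    have h2 := h (Set.mem_univ (t : ℝ))
    simp only [Function.comp_apply] at h2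
    simp [this, h2, F]

theorem LogRel.symm {S : Set ℂ} {p q : ℂ} (h : LogRel S p q) : LogRel S q p := by
  obtain ⟨g, hg, h⟩ := h
  refine ⟨fun z => -g z, hg.neg, fun z hz => ?_⟩
  rw [h z hz, mul_assoc, ← Complex.exp_add]
  simp

theorem LogRel.trans {S : Set ℂ} {p q r : ℂ} (h : LogRel S p q) (h' : LogRel S q r) :
    LogRel S p r := by
  obtain ⟨g, hg, h⟩ := h
  obtain ⟨g', hg', h'⟩ := h'
  refine ⟨fun z => g' z + g z, hg'.add hg, fun z hz => ?_⟩
  rw [h z hz, h' z hz, mul_assoc, ← Complex.exp_add]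

/-- The logarithm is obtained by lifting the homotopy `(t, z) ↦ (z - γ 0) / (z - γ t)` through the
covering `Complex.exp`. -/
theorem logRel_of_path {S : Set ℂ} {γ : unitInterval → ℂ} (hγ : Continuous γ)
    (hS : ∀ t, γ t ∉ S) : LogRel S (γ 0) (γ 1) := by
  have hne : ∀ (t : unitInterval) (z : S), (z : ℂ) - γ t ≠ 0 := fun t z h =>
    hS t (by rw [← sub_eq_zero.1 h]; exact z.2)
  let H : C(unitInterval × S, {z : ℂ // z ≠ 0}) :=
    ⟨fun x => ⟨((x.2 : ℂ) - γ 0) / ((x.2 : ℂ) - γ x.1), div_ne_zero (hne _ _) (hne _ _)⟩, by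
      refine Continuous.subtype_mk ?_ _
      exact Continuous.div (by fun_prop) (by fun_prop) fun x => hne _ _⟩
  have h0 : ∀ a : S, H (0, a) = ⟨Complex.exp ((0 : C(S, ℂ)) a), Complex.exp_ne_zero _⟩ := fun a =>
    Subtype.ext (by simp [H, div_self (hne 0 a)])
  let L := Complex.isCoveringMap_exp.liftHomotopy H 0 h0
  have hL : ∀ z : S, ((z : ℂ) - γ 0) / ((z : ℂ) - γ 1) = Complex.exp (L (1, z)) := fun z =>
    (congrArg Subtype.val
      (congr_fun (Complex.isCoveringMap_exp.liftHomotopy_lifts H 0 h0) (1, z))).symm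
  classical
  refine ⟨fun z => if hz : z ∈ S then L (1, ⟨z, hz⟩) else 0, ?_, fun z hz => ?_⟩
  · rw [continuousOn_iff_continuous_domRestrict]
    have : Continuous fun z : S => L (1, z) := by fun_prop
    exact this.congr fun z => by rw [Set.domRestrict_apply, dif_pos z.2]
  · dsimp only
    rw [dif_pos hz, ← hL ⟨z, hz⟩, mul_div_cancel₀ _ (hne 1 ⟨z, hz⟩)]

theorem IsPlaneArc.logRel {A S : Set ℂ} {p q : ℂ} (hA : IsPlaneArc A p q) (h : Disjoint A S) :
    LogRel S p q := by
  obtain ⟨γ, hγ, -, rfl, rfl, rfl⟩ := hA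
  exact logRel_of_path hγ fun t => Set.disjoint_left.1 h (Set.mem_range_self t)

theorem logRel_of_mem_connectedComponentIn {K : Set ℂ} (hK : IsClosed K) {p q : ℂ}
    (h : q ∈ connectedComponentIn Kᶜ p) : LogRel K p q := by
  have hp : p ∈ Kᶜ := connectedComponentIn_nonempty_iff.1 ⟨q, h⟩
  have hpc : IsPathConnected (connectedComponentIn Kᶜ p) :=
    (hK.isOpen_compl.connectedComponentIn.isConnected_iff_isPathConnected).1
      (isConnected_connectedComponentIn_iff.2 hp)
  obtain ⟨γ, hγ⟩ := hpc.joinedIn p (mem_connectedComponentIn hp) q h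
  have := logRel_of_path (S := K) (γ := γ) γ.continuous
    fun t => connectedComponentIn_subset _ _ (hγ t)
  simpa using this

/-- No nonzero power of `z - p` has a continuous logarithm on a circle around `p`. -/
theorem eq_zero_of_pow_eq_exp_on_sphere {p : ℂ} {r : ℝ} (hr : 0 < r) {k : ℤ} {g : ℂ → ℂ}
    (hg : ContinuousOn g (Metric.sphere p r))
    (h : ∀ z ∈ Metric.sphere p r, (z - p) ^ k = Complex.exp (g z)) : k = 0 := by
  let c : ℝ → ℂ := circleMap p r
  have hc : ∀ t, c t ∈ Metric.sphere p r := circleMap_mem_sphere p hr.le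
  have hcc : Continuous c := continuous_circleMap p r
  have hG : Continuous fun t => g (c t) := hg.comp_continuous hcc hc
  have key : ∀ t : ℝ, Complex.exp (g (c t)) =
      Complex.exp (g (c 0) + k * (t * Complex.I)) := fun t => by
    rw [Complex.exp_add, ← h _ (hc t), ← h _ (hc 0), Complex.exp_int_mul]
    simp [c, circleMap, mul_zpow]
  have := eqOn_of_exp_eqOn (S := Set.univ) isPreconnected_univ hG.continuousOn
    (h := fun t : ℝ => g (c 0) + k * (t * Complex.I)) (by fun_prop) (fun t _ => key t)
    (Set.mem_univ 0) (by simp) (Set.mem_univ (2 * Real.pi))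
  have hper : c (2 * Real.pi) = c 0 := by simp [c, circleMap]
  simp only [hper, left_eq_add] at this
  simpa [Real.pi_ne_zero] using this

/-! ### Separation of the plane by compact sets -/

/-- If `(z - p) ^ k` agreed on the boundary of `P` with a function that extends to a function
without zeros on `closure P`, then it could be changed inside `P` to a function without
zeros on the whole plane; that has a logarithm, also on a large circle around `P`. -/
theorem eq_zero_of_pow_eq_mul_exp_on_frontier {P : Set ℂ} (hPo : IsOpen P)
    (hPb : Bornology.IsBounded P) {p : ℂ} (hp : p ∈ P) {k : ℤ} {u g : ℂ → ℂ}
    (hu : ContinuousOn u (closure P)) (hu0 : ∀ z ∈ closure P, u z ≠ 0)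
    (hg : ContinuousOn g (frontier P))
    (h : ∀ z ∈ frontier P, (z - p) ^ k = u z * Complex.exp (g z)) : k = 0 := by
  obtain ⟨G, hG⟩ := ContinuousMap.exists_restrict_eq (isClosed_frontier (s := P))
    (⟨_, continuousOn_iff_continuous_domRestrict.1 hg⟩ : C(frontier P, ℂ))
  have hG' : ∀ z ∈ frontier P, G z = g z := fun z hz => DFunLike.congr_fun hG ⟨z, hz⟩
  classical
  let f : ℂ → ℂ := fun z => if z ∈ closure P then u z * Complex.exp (G z) else (z - p) ^ k
  have hf1 : ∀ z ∈ closure P, f z = u z * Complex.exp (G z) := fun z hz => if_pos hz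
  have hf2 : ∀ z ∈ Pᶜ, f z = (z - p) ^ k := fun z hz => by
    by_cases hzc : z ∈ closure P
    · have hzf : z ∈ frontier P := by rw [hPo.frontier_eq]; exact ⟨hzc, hz⟩
      rw [hf1 z hzc, hG' z hzf, h z hzf]
    · exact if_neg hzc
  have hne : ∀ z ∈ Pᶜ, z - p ≠ 0 := fun z hz => sub_ne_zero.2 (by rintro rfl; exact hz hp)
  have hpow : ContinuousOn (fun z : ℂ => (z - p) ^ k) Pᶜ :=
    ContinuousOn.zpow₀ (by fun_prop) k fun z hz => Or.inl (hne z hz)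
  have hf : Continuous f := by
    have : ContinuousOn f (closure P ∪ Pᶜ) :=
      ((hu.mul (by fun_prop)).congr hf1).union_of_isClosed
        (hpow.congr hf2)
        isClosed_closure hPo.isClosed_compl
    have hun : closure P ∪ Pᶜ = Set.univ :=
      Set.eq_univ_of_forall fun z => by
        by_cases hz : z ∈ P
        · exact Or.inl (subset_closure hz)
        · exact Or.inr hz
    rwa [hun, continuousOn_univ] at this
  have hf0 : ∀ z, f z ≠ 0 := fun z => by
    by_cases hz : z ∈ closure P
    · rw [hf1 z hz]; exact mul_ne_zero (hu0 z hz) (Complex.exp_ne_zero _)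
    · have hz' : z ∈ Pᶜ := fun hzP => hz (subset_closure hzP)
      rw [hf2 z hz']
      exact zpow_ne_zero _ (hne z hz')
  obtain ⟨R, hR0, hR⟩ := hPb.subset_ball_lt 0 p
  obtain ⟨L, hL, hfL⟩ := HasLogs.ball p (r := R + 1) (by linarith) f hf.continuousOn
    fun z _ => hf0 z
  have hsub : Metric.sphere p R ⊆ Metric.ball p (R + 1) := fun z hz => by
    rw [Metric.mem_ball, Metric.mem_sphere.1 hz]; linarith
  refine eq_zero_of_pow_eq_exp_on_sphere hR0 (hL.mono hsub) fun z hz => ?_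
  rw [← hfL z (hsub hz), hf2 z]
  intro hzP
  exact (Metric.mem_ball.1 (hR hzP)).ne (Metric.mem_sphere.1 hz)

theorem closure_connectedComponentIn_inter {U : Set ℂ} (hU : IsOpen U) (z : ℂ) :
    closure (connectedComponentIn U z) ∩ U ⊆ connectedComponentIn U z := by
  rintro w ⟨hw, hwU⟩
  obtain ⟨v, hv1, hv2⟩ := mem_closure_iff.1 hw _ hU.connectedComponentIn
    (mem_connectedComponentIn hwU)
  have := (connectedComponentIn_eq hv1).trans (connectedComponentIn_eq hv2).symm
  rw [← this]; exact mem_connectedComponentIn hwU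

theorem frontier_connectedComponentIn_subset {K : Set ℂ} (hK : IsClosed K) (z : ℂ) :
    frontier (connectedComponentIn Kᶜ z) ⊆ K := by
  intro w hw
  by_contra hwK
  rw [hK.isOpen_compl.connectedComponentIn.frontier_eq] at hw
  exact hw.2 (closure_connectedComponentIn_inter hK.isOpen_compl z ⟨hw.1, hwK⟩)

/-- A connected open set whose boundary is in `K` is a component of the complement of `K`. -/
theorem eq_connectedComponentIn_of_frontier_subset {K P : Set ℂ} (hP : IsOpen P)
    (hc : IsPreconnected P) (hPK : Disjoint P K) (hfr : frontier P ⊆ K) {z : ℂ} (hz : z ∈ P) :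
    P = connectedComponentIn Kᶜ z := by
  have hPK' : P ⊆ Kᶜ := fun w hw => Set.disjoint_left.1 hPK hw
  refine (hc.subset_connectedComponentIn hz hPK').antisymm ?_
  refine isPreconnected_connectedComponentIn.subset_of_closure_inter_subset hP
    ⟨z, mem_connectedComponentIn (hPK' hz), hz⟩ ?_
  rintro w ⟨hw, hwc⟩
  by_contra hwP
  exact connectedComponentIn_subset _ _ hwc (hfr (by rw [hP.frontier_eq]; exact ⟨hw, hwP⟩))

/-- The exterior of a disc is the image of a half-plane under the exponential function. -/
theorem isPreconnected_compl_closedBall {R : ℝ} (hR : 0 < R) :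
    IsPreconnected (Metric.closedBall (0 : ℂ) R)ᶜ := by
  have h : (Metric.closedBall (0 : ℂ) R)ᶜ = Complex.exp '' {z | Real.log R < z.re} := by
    ext w
    simp only [Set.mem_compl_iff, Metric.mem_closedBall, dist_zero_right, not_le, Set.mem_image,
      Set.mem_ofPred_eq]
    constructor
    · intro hw
      have hw0 : w ≠ 0 := by rintro rfl; simp at hw; linarith
      exact ⟨Complex.log w, by rw [Complex.log_re]; exact Real.log_lt_log hR hw,
        Complex.exp_log hw0⟩
    · rintro ⟨z, hz, rfl⟩
      rw [Complex.norm_exp]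
      exact (Real.log_lt_iff_lt_exp hR).1 hz
  rw [h]
  exact (convex_halfSpace_re_gt _).isPreconnected.image _ Complex.continuous_exp.continuousOn

/-- Of two different components of the complement of a compact set, one is bounded. -/
theorem isBounded_connectedComponentIn_or {K : Set ℂ} (hK : IsCompact K) {p q : ℂ}
    (h : q ∉ connectedComponentIn Kᶜ p) :
    Bornology.IsBounded (connectedComponentIn Kᶜ p) ∨
      Bornology.IsBounded (connectedComponentIn Kᶜ q) := by
  by_contra! hcon
  obtain ⟨R, hR0, hR⟩ := hK.isBounded.subset_ball_lt 0 0
  have hE : (Metric.closedBall (0 : ℂ) R)ᶜ ⊆ Kᶜ :=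
    Set.compl_subset_compl.2 (hR.trans Metric.ball_subset_closedBall)
  have key : ∀ v, ¬ Bornology.IsBounded (connectedComponentIn Kᶜ v) →
      (Metric.closedBall (0 : ℂ) R)ᶜ ⊆ connectedComponentIn Kᶜ v := by
    intro v hv
    obtain ⟨w, hw, hwR⟩ := Set.not_subset.1 fun hs => hv (Metric.isBounded_closedBall.subset hs)
    rw [connectedComponentIn_eq hw]
    exact (isPreconnected_compl_closedBall hR0).subset_connectedComponentIn hwR hE
  obtain ⟨w, hw⟩ : (Metric.closedBall (0 : ℂ) R)ᶜ.Nonempty :=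
    ⟨((R + 1 : ℝ) : ℂ), by
      simp only [Set.mem_compl_iff, Metric.mem_closedBall, dist_zero_right, Complex.norm_real,
        Real.norm_eq_abs, not_le]
      exact (lt_add_one R).trans_le (le_abs_self _)⟩
  have heq := (connectedComponentIn_eq (key p hcon.1 hw)).trans
    (connectedComponentIn_eq (key q hcon.2 hw)).symm
  obtain ⟨v, hv⟩ : (connectedComponentIn Kᶜ q).Nonempty := ⟨w, key q hcon.2 hw⟩
  exact h (heq ▸ mem_connectedComponentIn (connectedComponentIn_nonempty_iff.1 ⟨v, hv⟩))

/-- Points in different components of the complement of `K` are multiplicatively independent: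
a product of powers `(z - p i) ^ k i` of total degree zero has a continuous logarithm on `K` only
if all exponents vanish. -/
theorem exponents_eq_zero {ι : Type*} [Fintype ι] {K : Set ℂ} (hK : IsCompact K) {p : ι → ℂ}
    (hp : ∀ i, p i ∉ K) (hd : ∀ i j, i ≠ j → p j ∉ connectedComponentIn Kᶜ (p i))
    {k : ι → ℤ} (hk : ∑ i, k i = 0) {g : ℂ → ℂ} (hg : ContinuousOn g K)
    (h : ∀ z ∈ K, ∏ i, (z - p i) ^ k i = Complex.exp (g z)) (i : ι) : k i = 0 := by
  classical
  have hb : ∀ i, Bornology.IsBounded (connectedComponentIn Kᶜ (p i)) → k i = 0 := by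
    intro i hi
    have hfr := frontier_connectedComponentIn_subset hK.isClosed (p i)
    have hne : ∀ j ∈ Finset.univ.erase i, ∀ z ∈ closure (connectedComponentIn Kᶜ (p i)),
        z - p j ≠ 0 := fun j hj z hz h0 => by
      rw [sub_eq_zero.1 h0] at hz
      exact hd i j (Finset.ne_of_mem_erase hj).symm
        (closure_connectedComponentIn_inter hK.isClosed.isOpen_compl _ ⟨hz, hp j⟩)
    refine eq_zero_of_pow_eq_mul_exp_on_frontier hK.isClosed.isOpen_compl.connectedComponentIn hi
      (mem_connectedComponentIn (hp i)) (g := g)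
      (u := fun z => ∏ j ∈ Finset.univ.erase i, (z - p j) ^ (-k j)) ?_ ?_ (hg.mono hfr) ?_
    · exact continuousOn_finsetProd _ fun j hj =>
        ContinuousOn.zpow₀ (by fun_prop) _ fun z hz => Or.inl (hne j hj z hz)
    · exact fun z hz => Finset.prod_ne_zero_iff.2 fun j hj => zpow_ne_zero _ (hne j hj z hz)
    · intro z hz
      rw [← h z (hfr hz), ← Finset.mul_prod_erase _ _ (Finset.mem_univ i), mul_left_comm,
        ← Finset.prod_mul_distrib, Finset.prod_eq_one, mul_one]
      intro j hj
      rw [← zpow_add₀ (hne j hj z (frontier_subset_closure hz))]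
      simp
  by_cases hi : Bornology.IsBounded (connectedComponentIn Kᶜ (p i))
  · exact hb i hi
  -- At most one of the components is unbounded; its exponent is minus the sum of the others.
  · rw [← Finset.add_sum_erase _ _ (Finset.mem_univ i), Finset.sum_eq_zero, add_zero] at hk
    · exact hk
    · intro j hj
      exact hb j ((isBounded_connectedComponentIn_or hK
        (hd i j (Finset.ne_of_mem_erase hj).symm)).resolve_left hi)

/-- Eilenberg's criterion; `logRel_of_mem_connectedComponentIn` is the converse. -/
theorem mem_connectedComponentIn_of_logRel {K : Set ℂ} (hK : IsCompact K) {p q : ℂ}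
    (hp : p ∉ K) (hq : q ∉ K) (h : LogRel K p q) : q ∈ connectedComponentIn Kᶜ p := by
  by_contra hcon
  have hcon' : p ∉ connectedComponentIn Kᶜ q := fun hpq =>
    hcon (connectedComponentIn_eq hpq ▸ mem_connectedComponentIn hq)
  obtain ⟨g, hg, h⟩ := h
  have := exponents_eq_zero hK (p := ![p, q]) (k := ![1, -1]) (g := g)
    (by simp [Fin.forall_fin_two, hp, hq])
    (by simp [Fin.forall_fin_two, hcon, hcon']) (by simp) hg ?_ 0
  · simp at this
  · intro z hz
    have hzq : z - q ≠ 0 := sub_ne_zero.2 (by rintro rfl; exact hq hz)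
    simp [Fin.prod_univ_two, h z hz]
    field_simp

/-- A compact set on which all functions without zeros have logarithms, such as an arc, does not
separate the plane. -/
theorem HasLogs.mem_connectedComponentIn {K : Set ℂ} (hK : IsCompact K) (hl : HasLogs K)
    {p q : ℂ} (hp : p ∉ K) (hq : q ∉ K) : q ∈ connectedComponentIn Kᶜ p := by
  have h : ∀ p, p ∉ K → ∀ z ∈ K, z - p ≠ 0 := fun p hp z hz =>
    sub_ne_zero.2 (by rintro rfl; exact hp hz)
  obtain ⟨g, hg, hgz⟩ := hl (fun z => (z - p) / (z - q))
    (ContinuousOn.div (by fun_prop) (by fun_prop) (h q hq))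
    (fun z hz => div_ne_zero (h p hp z hz) (h q hq z hz))
  refine mem_connectedComponentIn_of_logRel hK hp hq ⟨g, hg, fun z hz => ?_⟩
  rw [← hgz z hz, mul_div_cancel₀ _ (h q hq z hz)]

/-- Two functions on closed sets that meet in `x` and `y` can be glued after subtracting a constant
from the second one, if their differences at `x` and at `y` agree. -/
theorem exists_continuousOn_union {K A : Set ℂ} (hK : IsClosed K) (hA : IsClosed A) {x y : ℂ}
    (hAK : A ∩ K = {x, y}) {g h : ℂ → ℂ} (hg : ContinuousOn g K) (hh : ContinuousOn h A)
    (hxy : h x - g x = h y - g y) :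
    ∃ G : ℂ → ℂ, ContinuousOn G (K ∪ A) ∧ (∀ z ∈ K, G z = g z) ∧
      ∀ z ∈ A, G z = h z - (h x - g x) := by
  classical
  let G : ℂ → ℂ := fun z => if z ∈ K then g z else h z - (h x - g x)
  have h1 : ∀ z ∈ K, G z = g z := fun z hz => if_pos hz
  have h2 : ∀ z ∈ A, G z = h z - (h x - g x) := fun z hz => by
    by_cases hzK : z ∈ K
    · rw [h1 z hzK]
      have hz' : z ∈ A ∩ K := ⟨hz, hzK⟩
      rw [hAK] at hz'
      obtain rfl | rfl := hz'
      · ring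
      · rw [hxy]; ring
    · exact if_neg hzK
  exact ⟨G, (hg.congr h1).union_of_isClosed ((hh.sub continuousOn_const).congr h2) hK hA, h1, h2⟩

theorem HasLogs.union {A B : Set ℂ} (hAc : IsClosed A) (hBc : IsClosed B) (hA : HasLogs A)
    (hB : HasLogs B) {x : ℂ} (hAB : A ∩ B = {x}) : HasLogs (A ∪ B) := by
  intro f hf h0
  obtain ⟨g, hg, hgf⟩ := hA f (hf.mono Set.subset_union_left) fun z hz => h0 z (Or.inl hz)
  obtain ⟨h, hh, hhf⟩ := hB f (hf.mono Set.subset_union_right) fun z hz => h0 z (Or.inr hz)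
  have hx : x ∈ A ∩ B := by rw [hAB]; rfl
  obtain ⟨G, hG, hGg, hGh⟩ := exists_continuousOn_union hAc hBc (x := x) (y := x)
    (by rw [Set.inter_comm, hAB, Set.pair_eq_singleton]) hg hh rfl
  refine ⟨G, hG, ?_⟩
  rintro z (hz | hz)
  · rw [hGg z hz, hgf z hz]
  · rw [hGh z hz, Complex.exp_sub, Complex.exp_sub, ← hhf x hx.2, ← hgf x hx.1,
      div_self (h0 x (Or.inl hx.1)), div_one, hhf z hz]

/-- Adding an arc to a compact set that it meets in its two ends splits a component of the
complement into at most two: the obstruction to extending the logarithm of `(z - p) / (z - q)`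
over the arc is an integer, and the integers of two pairs are linearly dependent. -/
theorem mem_connectedComponentIn_union_arc {K A : Set ℂ} (hK : IsCompact K) (hA : IsCompact A)
    (hAl : HasLogs A) {x y : ℂ} (hAK : A ∩ K = {x, y}) {p q r : ℂ} (hp : p ∉ A) (hq : q ∉ A)
    (hr : r ∉ A) (hpq : q ∈ connectedComponentIn Kᶜ p) (hpr : r ∈ connectedComponentIn Kᶜ p) :
    q ∈ connectedComponentIn (K ∪ A)ᶜ p ∨ r ∈ connectedComponentIn (K ∪ A)ᶜ p ∨
      r ∈ connectedComponentIn (K ∪ A)ᶜ q := by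
  have hpK : p ∉ K := connectedComponentIn_nonempty_iff.1 ⟨q, hpq⟩
  have hqK : q ∉ K := connectedComponentIn_subset _ _ hpq
  have hrK : r ∉ K := connectedComponentIn_subset _ _ hpr
  have hp' : p ∉ K ∪ A := by simp [hpK, hp]
  have hq' : q ∉ K ∪ A := by simp [hqK, hq]
  have hr' : r ∉ K ∪ A := by simp [hrK, hr]
  have hne : ∀ v, v ∉ K ∪ A → ∀ z ∈ K ∪ A, z - v ≠ 0 := fun v hv z hz =>
    sub_ne_zero.2 (by rintro rfl; exact hv hz)
  have hx : x ∈ A ∩ K := by rw [hAK]; simp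
  have hy : y ∈ A ∩ K := by rw [hAK]; simp
  have hlog : ∀ v, v ∉ K ∪ A → v ∈ connectedComponentIn Kᶜ p →
      ∃ (g h : ℂ → ℂ) (m n : ℤ), ContinuousOn g K ∧ ContinuousOn h A ∧
        (∀ z ∈ K, (z - p) / (z - v) = Complex.exp (g z)) ∧
        (∀ z ∈ A, (z - p) / (z - v) = Complex.exp (h z)) ∧
        h x - g x = m * (2 * Real.pi * Complex.I) ∧ h y - g y = n * (2 * Real.pi * Complex.I) := by
    intro v hv hpv
    obtain ⟨g, hg, hgz⟩ := logRel_of_mem_connectedComponentIn hK.isClosed hpv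
    obtain ⟨h, hh, hhz⟩ := hAl (fun z => (z - p) / (z - v))
      (ContinuousOn.div (by fun_prop) (by fun_prop) fun z hz => hne v hv z (Or.inr hz))
      (fun z hz => div_ne_zero (hne p hp' z (Or.inr hz)) (hne v hv z (Or.inr hz)))
    have hg' : ∀ z ∈ K, (z - p) / (z - v) = Complex.exp (g z) := fun z hz => by
      rw [hgz z hz, mul_div_cancel_left₀ _ (hne v hv z (Or.inl hz))]
    have hint : ∀ z ∈ A ∩ K, ∃ m : ℤ, h z - g z = m * (2 * Real.pi * Complex.I) := fun z hz => by
      refine Complex.exp_eq_one_iff.1 ?_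
      rw [Complex.exp_sub, ← hg' z hz.2, ← hhz z hz.1, div_self]
      exact div_ne_zero (hne p hp' z (Or.inl hz.2)) (hne v hv z (Or.inl hz.2))
    obtain ⟨m, hm⟩ := hint x hx
    obtain ⟨n, hn⟩ := hint y hy
    exact ⟨g, h, m, n, hg, hh, hg', hhz, hm, hn⟩
  obtain ⟨g, h, m, n, hg, hh, hgz, hhz, hm, hn⟩ := hlog q hq' hpq
  obtain ⟨g', h', m', n', hg', hh', hgz', hhz', hm', hn'⟩ := hlog r hr' hpr
  have hKA : IsCompact (K ∪ A) := hK.union hA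
  have hone : ∀ l : ℤ, Complex.exp (l * (2 * Real.pi * Complex.I)) = 1 := fun l =>
    Complex.exp_eq_one_iff.2 ⟨l, rfl⟩
  by_contra! hcon
  obtain ⟨hpq', hpr', hqr'⟩ := hcon
  have hmn : m - n ≠ 0 := by
    intro hmn
    refine hpq' ?_
    obtain ⟨G, hG, hGg, hGh⟩ := exists_continuousOn_union hK.isClosed hA.isClosed hAK hg hh
      (by rw [hm, hn, sub_eq_zero.1 hmn])
    refine mem_connectedComponentIn_of_logRel hKA hp' hq' ⟨G, hG, fun z hz => ?_⟩
    have hz0 := hne q hq' z hz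
    rw [eq_comm, mul_comm, ← eq_div_iff hz0, eq_comm]
    rcases hz with hz | hz
    · rw [hGg z hz, hgz z hz]
    · rw [hGh z hz, hm, Complex.exp_sub, hone, div_one, hhz z hz]
  -- Eliminating the two obstructions `m - n` and `m' - n'` against each other gives a product of
  -- powers that does have a logarithm on the union.
  obtain ⟨a, ha⟩ : ∃ a : ℤ, a = m' - n' := ⟨_, rfl⟩
  obtain ⟨b, hb⟩ : ∃ b : ℤ, b = m - n := ⟨_, rfl⟩
  have ex : (a * h x - b * h' x) - (a * g x - b * g' x) =
      ((a * m - b * m' : ℤ) : ℂ) * (2 * Real.pi * Complex.I) := by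
    push_cast
    linear_combination (a : ℂ) * hm - b * hm'
  have ey : (a * h y - b * h' y) - (a * g y - b * g' y) =
      ((a * n - b * n' : ℤ) : ℂ) * (2 * Real.pi * Complex.I) := by
    push_cast
    linear_combination (a : ℂ) * hn - b * hn'
  obtain ⟨G, hG, hGg, hGh⟩ := exists_continuousOn_union hK.isClosed hA.isClosed hAK
    (g := fun z => a * g z - b * g' z) (h := fun z => a * h z - b * h' z)
    (by fun_prop) (by fun_prop) (by
      rw [ex, ey, show a * m - b * m' = a * n - b * n' by rw [ha, hb]; ring])
  have hprod : ∀ z ∈ K ∪ A, ∏ i, (z - ![p, q, r] i) ^ (![a - b, -a, b] i) =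
      ((z - p) / (z - q)) ^ a / ((z - p) / (z - r)) ^ b := fun z hz => by
    have h1 := hne p hp' z hz
    have h2 := hne q hq' z hz
    have h3 := hne r hr' z hz
    simp only [Fin.prod_univ_three, Matrix.cons_val_zero, Matrix.cons_val_one, Matrix.cons_val]
    rw [zpow_sub₀ h1, zpow_neg, div_zpow, div_zpow]
    have := zpow_ne_zero a h1
    have := zpow_ne_zero b h1
    have := zpow_ne_zero a h2
    have := zpow_ne_zero b h3
    field_simp
  have hsymm : ∀ {u v : ℂ}, v ∉ K ∪ A → v ∉ connectedComponentIn (K ∪ A)ᶜ u →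
      u ∉ connectedComponentIn (K ∪ A)ᶜ v := fun hv huv hvu =>
    huv (connectedComponentIn_eq hvu ▸ mem_connectedComponentIn hv)
  have := exponents_eq_zero hKA (p := ![p, q, r]) (k := ![a - b, -a, b]) (g := G)
    (by simp only [Fin.forall_fin_succ]; simp [hpK, hqK, hrK, hp, hq, hr])
    (by
      intro i j hij
      fin_cases i <;> fin_cases j <;> first | exact absurd rfl hij | skip
      exacts [hpq', hpr', hsymm hq' hpq', hqr', hsymm hr' hpr', hsymm hr' hqr'])
    (by
      simp only [Fin.sum_univ_three, Matrix.cons_val_zero, Matrix.cons_val_one, Matrix.cons_val]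
      ring) hG
    (by
      intro z hz
      rw [hprod z hz]
      rcases hz with hz | hz
      · rw [hGg z hz, Complex.exp_sub, Complex.exp_int_mul, Complex.exp_int_mul, hgz z hz,
          hgz' z hz]
      · rw [hGh z hz, ex, Complex.exp_sub, hone, div_one, Complex.exp_sub, Complex.exp_int_mul,
          Complex.exp_int_mul, hhz z hz, hhz' z hz]) 2
  exact hmn (by simpa [hb] using this)

/-- The separation half of the Jordan curve theorem: a closed curve made of two arcs separates the
plane. If its complement were connected, the logarithms of `(z - x) / (z - y)` on the complements
of the two arcs could be matched, giving a logarithm on `{x, y}ᶜ`, which is absurd near `x`. -/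
theorem not_isPreconnected_compl_union {A B : Set ℂ} (hA : IsClosed A) (hB : IsClosed B) {x y : ℂ}
    (hxy : x ≠ y) (hAB : A ∩ B = {x, y}) (hAl : LogRel Aᶜ x y) (hBl : LogRel Bᶜ x y)
    (hne : (A ∪ B)ᶜ.Nonempty) : ¬ IsPreconnected (A ∪ B)ᶜ := by
  intro hc
  obtain ⟨g, hg, hgz⟩ := hAl
  obtain ⟨h, hh, hhz⟩ := hBl
  obtain ⟨w, hw⟩ := hne
  have hsA : (A ∪ B)ᶜ ⊆ Aᶜ := Set.compl_subset_compl.2 Set.subset_union_left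
  have hsB : (A ∪ B)ᶜ ⊆ Bᶜ := Set.compl_subset_compl.2 Set.subset_union_right
  have hyA : y ∈ A ∩ B := by rw [hAB]; simp
  have hexp : ∀ z ∈ (A ∪ B)ᶜ, Complex.exp (g z) = Complex.exp (h z) := fun z hz => by
    have hzy : z - y ≠ 0 := sub_ne_zero.2 (by rintro rfl; exact hz (Or.inl hyA.1))
    exact mul_left_cancel₀ hzy ((hgz z (hsA hz)).symm.trans (hhz z (hsB hz)))
  let c := g w - h w
  have hcexp : Complex.exp c = 1 := by
    simp only [c]
    rw [Complex.exp_sub, hexp w hw, div_self (Complex.exp_ne_zero _)]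
  have heq : Set.EqOn g (fun z => h z + c) (A ∪ B)ᶜ :=
    eqOn_of_exp_eqOn hc (hg.mono hsA) ((hh.mono hsB).add continuousOn_const)
      (fun z hz => by rw [Complex.exp_add, hcexp, mul_one, hexp z hz]) hw (by simp [c])
  classical
  let L : ℂ → ℂ := fun z => if z ∈ Aᶜ then g z else h z + c
  have hLA : ∀ z ∈ Aᶜ, L z = g z := fun z hz => if_pos hz
  have hLB : ∀ z ∈ Bᶜ, L z = h z + c := fun z hz => by
    by_cases hzA : z ∈ Aᶜ
    · rw [hLA z hzA]
      exact heq (by simpa using And.intro hzA hz)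
    · exact if_neg hzA
  have hL : ContinuousOn L (Aᶜ ∪ Bᶜ) :=
    (hg.congr hLA).union_of_isOpen ((hh.add continuousOn_const).congr hLB)
      hA.isOpen_compl hB.isOpen_compl
  have hLz : ∀ z ∈ Aᶜ ∪ Bᶜ, z - x = (z - y) * Complex.exp (L z) := by
    rintro z (hz | hz)
    · rw [hLA z hz, hgz z hz]
    · rw [hLB z hz, hhz z hz, Complex.exp_add, hcexp, mul_one]
  rw [← Set.compl_inter, hAB] at hL hLz
  have hd : 0 < dist x y := dist_pos.2 hxy
  have hlt : ∀ z ∈ Metric.sphere x (dist x y / 2), z ∈ Metric.ball x (dist x y) := fun z hz => by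
    rw [Metric.mem_ball, Metric.mem_sphere.1 hz]; linarith
  have hsub : ∀ z ∈ Metric.sphere x (dist x y / 2), z ∈ ({x, y} : Set ℂ)ᶜ := by
    rintro z hz (rfl | rfl)
    · exact (half_pos hd).ne (by simpa using hz)
    · have := Metric.mem_ball.1 (hlt _ hz)
      rw [dist_comm] at this
      exact this.false
  obtain ⟨M, hM, hMz⟩ := HasLogs.ball x hd (fun z => z - y) (by fun_prop) fun z hz h0 => by
    rw [sub_eq_zero.1 h0, Metric.mem_ball, dist_comm] at hz
    exact hz.false
  refine one_ne_zero (eq_zero_of_pow_eq_exp_on_sphere (p := x) (k := 1) (half_pos hd)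
    ((hM.mono hlt).add (hL.mono hsub)) fun z hz => ?_)
  rw [zpow_one, hLz z (hsub z hz), Pi.add_apply, Complex.exp_add, ← hMz z (hlt z hz)]

/-! ### Further properties of arcs -/

theorem IsPlaneArc.isCompact {A : Set ℂ} {p q : ℂ} (hA : IsPlaneArc A p q) : IsCompact A := by
  obtain ⟨γ, hγ, -, -, -, rfl⟩ := hA
  exact isCompact_range hγ

theorem IsPlaneArc.left_mem {A : Set ℂ} {p q : ℂ} (hA : IsPlaneArc A p q) : p ∈ A := by
  obtain ⟨γ, -, -, rfl, -, rfl⟩ := hA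
  exact Set.mem_range_self 0

theorem IsPlaneArc.right_mem {A : Set ℂ} {p q : ℂ} (hA : IsPlaneArc A p q) : q ∈ A := by
  obtain ⟨γ, -, -, -, rfl, rfl⟩ := hA
  exact Set.mem_range_self 1

theorem IsPlaneArc.isPreconnected {A : Set ℂ} {p q : ℂ} (hA : IsPlaneArc A p q) :
    IsPreconnected A := by
  obtain ⟨γ, hγ, -, -, -, rfl⟩ := hA
  exact isPreconnected_range hγ

theorem IsPlaneArc.exists_mem_ne {A : Set ℂ} {p q : ℂ} (hA : IsPlaneArc A p q) :
    ∃ z ∈ A, z ≠ p ∧ z ≠ q := by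
  obtain ⟨γ, -, hinj, rfl, rfl, rfl⟩ := hA
  let t : unitInterval := ⟨1 / 2, by norm_num, by norm_num⟩
  have h0 : t ≠ 0 := fun h => by have := congrArg Subtype.val h; norm_num [t] at this
  have h1 : t ≠ 1 := fun h => by have := congrArg Subtype.val h; norm_num [t] at this
  exact ⟨γ t, Set.mem_range_self t, hinj.ne h0, hinj.ne h1⟩

/-- A circle does not embed in an interval: a continuous real function on it takes the same
value at two opposite points. -/
theorem IsPlaneArc.interior_eq_empty {A : Set ℂ} {p q : ℂ} (hA : IsPlaneArc A p q) :
    interior A = ∅ := by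
  obtain ⟨γ, hγ, hinj, -, -, rfl⟩ := hA
  by_contra hne
  obtain ⟨c, hc⟩ := Set.nonempty_iff_ne_empty.2 hne
  obtain ⟨r, hr, hrs⟩ := Metric.nhds_basis_closedBall.mem_iff.1 (mem_interior_iff_mem_nhds.1 hc)
  have hmem : ∀ θ, circleMap c r θ ∈ Set.range γ := fun θ =>
    hrs (Metric.sphere_subset_closedBall (circleMap_mem_sphere c hr.le θ))
  let e := (hγ.isClosedEmbedding hinj).isEmbedding.toHomeomorph
  let φ : ℝ → ℝ := fun θ => e.symm ⟨circleMap c r θ, hmem θ⟩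
  have hφ : Continuous φ := continuous_subtype_val.comp
    (e.symm.continuous.comp ((continuous_circleMap c r).subtype_mk hmem))
  let d : ℝ → ℝ := fun θ => φ θ - φ (θ + Real.pi)
  have hd : Continuous d := by fun_prop
  have hπ : d Real.pi = -d 0 := by
    have : φ (Real.pi + Real.pi) = φ 0 := by
      have h2 : circleMap c r (Real.pi + Real.pi) = circleMap c r 0 := by
        rw [← two_mul]; simpa using periodic_circleMap c r 0
      simp only [φ, h2]
    simp only [d, this, zero_add, neg_sub]
  have hz : (0 : ℝ) ∈ Set.uIcc (d 0) (d Real.pi) := by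
    rw [hπ, Set.mem_uIcc]
    rcases le_total 0 (d 0) with h | h
    · right; constructor <;> linarith
    · left; constructor <;> linarith
  obtain ⟨θ, -, hθ⟩ := intermediate_value_uIcc hd.continuousOn hz
  have h1 : circleMap c r θ = circleMap c r (θ + Real.pi) :=
    congrArg Subtype.val (e.symm.injective (Subtype.ext (sub_eq_zero.1 hθ)))
  have h2 : circleMap c r (θ + Real.pi) = c - r * Complex.exp (θ * Complex.I) := by
    simp [circleMap, add_mul, Complex.exp_add, sub_eq_add_neg]
  rw [h2] at h1
  simp only [circleMap] at h1
  have h3 : (r : ℂ) * Complex.exp (θ * Complex.I) = 0 := by linear_combination h1 / 2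
  simp [hr.ne'] at h3

/-! ### Plane drawings -/

namespace PlaneDrawing

variable {V : Type*} {G : SimpleGraph V} (D : PlaneDrawing G)

/-- The arc that represents the edge `e`, for an unordered pair `e` of vertices; it is empty if `e`
is not an edge. -/
def edgeArc (e : Sym2 V) : Set ℂ := ⋃ h : e ∈ G.edgeSet, D.arc ⟨e, h⟩

/-- The drawing of the closed walk `x`, `y`, `z`, `x`. -/
def tri (x y z : V) : Set ℂ := D.edgeArc s(x, y) ∪ D.edgeArc s(y, z) ∪ D.edgeArc s(z, x)

theorem edgeArc_eq {e : Sym2 V} (h : e ∈ G.edgeSet) : D.edgeArc e = D.arc ⟨e, h⟩ := by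
  simp [edgeArc, h]

theorem isPlaneArc_edgeArc {x y : V} (h : G.Adj x y) :
    IsPlaneArc (D.edgeArc s(x, y)) (D.point x) (D.point y) := by
  rw [D.edgeArc_eq (G.mem_edgeSet.2 h)]; exact D.isPlaneArc x y h

theorem isClosed_edgeArc (e : Sym2 V) : IsClosed (D.edgeArc e) := by
  induction e with | _ x y
  by_cases h : G.Adj x y
  · exact (D.isPlaneArc_edgeArc h).isCompact.isClosed
  · simp [edgeArc, h]

theorem isCompact_edgeArc (e : Sym2 V) : IsCompact (D.edgeArc e) := by
  induction e with | _ x y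
  by_cases h : G.Adj x y
  · exact (D.isPlaneArc_edgeArc h).isCompact
  · simp [edgeArc, h]

theorem interior_edgeArc (e : Sym2 V) : interior (D.edgeArc e) = ∅ := by
  induction e with | _ x y
  by_cases h : G.Adj x y
  · exact (D.isPlaneArc_edgeArc h).interior_eq_empty
  · simp [edgeArc, h]

theorem mem_of_point_mem_edgeArc {e : Sym2 V} {v : V} (h : D.point v ∈ D.edgeArc e) : v ∈ e := by
  obtain ⟨he, h⟩ := Set.mem_iUnion.1 h
  exact D.mem_of_point_mem_arc _ v h

theorem edgeArc_inter_edgeArc {e f : Sym2 V} (hef : e ≠ f) :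
    D.edgeArc e ∩ D.edgeArc f ⊆ Set.range D.point := by
  rintro z ⟨hz, hz'⟩
  obtain ⟨he, hz⟩ := Set.mem_iUnion.1 hz
  obtain ⟨hf, hz'⟩ := Set.mem_iUnion.1 hz'
  exact D.arc_inter_arc ⟨e, he⟩ ⟨f, hf⟩ (fun h => hef (congrArg Subtype.val h)) ⟨hz, hz'⟩

theorem exists_mem_of_mem_edgeArc_inter {e f : Sym2 V} (hef : e ≠ f) {z : ℂ}
    (he : z ∈ D.edgeArc e) (hf : z ∈ D.edgeArc f) : ∃ v, z = D.point v ∧ v ∈ e ∧ v ∈ f := by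
  obtain ⟨v, rfl⟩ := D.edgeArc_inter_edgeArc hef ⟨he, hf⟩
  exact ⟨v, rfl, D.mem_of_point_mem_edgeArc he, D.mem_of_point_mem_edgeArc hf⟩

theorem carrier_eq : D.carrier = Set.range D.point ∪ ⋃ e, D.edgeArc e := by
  simp only [carrier, edgeArc, Set.iUnion_coe_set]

theorem edgeArc_subset_carrier (e : Sym2 V) : D.edgeArc e ⊆ D.carrier := by
  rw [carrier_eq]
  exact (Set.subset_iUnion _ e).trans Set.subset_union_right

theorem point_mem_carrier (v : V) : D.point v ∈ D.carrier := Or.inl (Set.mem_range_self v)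

theorem tri_subset_carrier (x y z : V) : D.tri x y z ⊆ D.carrier :=
  Set.union_subset (Set.union_subset (D.edgeArc_subset_carrier _) (D.edgeArc_subset_carrier _))
    (D.edgeArc_subset_carrier _)

theorem tri_rotate (x y z : V) : D.tri x y z = D.tri y z x := by
  simp only [tri, Set.union_comm, Set.union_left_comm]

theorem tri_swap (x y z : V) : D.tri x y z = D.tri y x z := by
  simp only [tri, Sym2.eq_swap (a := y) (b := x), Sym2.eq_swap (a := x) (b := z),
    Sym2.eq_swap (a := z) (b := y)]
  rw [Set.union_assoc, Set.union_assoc, Set.union_comm (D.edgeArc s(y, z))]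

theorem mem_of_point_mem_tri {x y z v : V} (h : D.point v ∈ D.tri x y z) :
    v = x ∨ v = y ∨ v = z := by
  rcases h with (h | h) | h <;> have := Sym2.mem_iff.1 (D.mem_of_point_mem_edgeArc h) <;> tauto

theorem edgeArc_subset_tri (x y z : V) : D.edgeArc s(x, y) ⊆ D.tri x y z :=
  fun _ h => Or.inl (Or.inl h)

theorem isCompact_tri (x y z : V) : IsCompact (D.tri x y z) :=
  ((D.isCompact_edgeArc _).union (D.isCompact_edgeArc _)).union (D.isCompact_edgeArc _)

theorem isCompact_carrier [Finite V] : IsCompact D.carrier := by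
  rw [carrier_eq]
  exact (Set.finite_range _).isCompact.union (isCompact_iUnion D.isCompact_edgeArc)

/-- A finite union of closed sets without interior has no interior. -/
theorem interior_iUnion_edgeArc [Finite V] : interior (⋃ e, D.edgeArc e) = ∅ := by
  rw [← Set.biUnion_univ]
  induction (Set.univ : Set (Sym2 V)), Set.finite_univ (α := Sym2 V) using Set.Finite.induction_on with
  | empty => simp
  | @insert e s _ hs ih =>
    rw [Set.biUnion_insert, interior_union_isClosed_of_interior_empty (D.isClosed_edgeArc e),
      D.interior_edgeArc]
    exact ih

theorem dense_compl_carrier [Finite V] : Dense D.carrierᶜ := by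
  rw [← interior_eq_empty_iff_dense_compl, carrier_eq, Set.union_comm,
    interior_union_isClosed_of_interior_empty, D.interior_iUnion_edgeArc]
  · exact isClosed_iUnion_of_finite D.isClosed_edgeArc
  · exact interior_eq_empty_iff_dense_compl.2 ((Set.finite_range _).countable.dense_compl ℝ)

/-! ### The drawing of a triangle -/

/-- Two sides of a triangle, which meet in a single point, together behave like an arc. -/
theorem hasLogs_edgeArc_union {x y z : V} (hxy : G.Adj x y) (hyz : G.Adj y z) (hzx : G.Adj z x) :
    HasLogs (D.edgeArc s(y, z) ∪ D.edgeArc s(z, x)) := by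
  refine (D.isPlaneArc_edgeArc hyz).hasLogs.union (D.isClosed_edgeArc _) (D.isClosed_edgeArc _)
    (D.isPlaneArc_edgeArc hzx).hasLogs (x := D.point z) ?_
  ext w
  constructor
  · rintro ⟨h1, h2⟩
    obtain ⟨v, rfl, hv1, hv2⟩ := D.exists_mem_of_mem_edgeArc_inter (by
      have := hxy.ne; have := hyz.ne; have := hzx.ne
      simp only [ne_eq, Sym2.eq_iff]; tauto) h1 h2
    have := hxy.ne; have := hyz.ne; have := hzx.ne
    rw [Sym2.mem_iff] at hv1 hv2
    have : v = z := by rcases hv1 with rfl | rfl <;> tauto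
    rw [this]; rfl
  · rintro rfl
    exact ⟨(D.isPlaneArc_edgeArc hyz).right_mem, (D.isPlaneArc_edgeArc hzx).left_mem⟩

theorem edgeArc_inter_union {x y z : V} (hxy : G.Adj x y) (hyz : G.Adj y z) (hzx : G.Adj z x) :
    D.edgeArc s(x, y) ∩ (D.edgeArc s(y, z) ∪ D.edgeArc s(z, x)) = {D.point x, D.point y} := by
  have n1 := hxy.ne
  have n2 := hyz.ne
  have n3 := hzx.ne
  ext w
  constructor
  · rintro ⟨h1, h2 | h2⟩
    · obtain ⟨v, rfl, hv1, hv2⟩ := D.exists_mem_of_mem_edgeArc_inter (by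
        simp only [ne_eq, Sym2.eq_iff]; tauto) h1 h2
      rcases Sym2.mem_iff.1 hv1 with rfl | rfl <;> simp
    · obtain ⟨v, rfl, hv1, hv2⟩ := D.exists_mem_of_mem_edgeArc_inter (by
        simp only [ne_eq, Sym2.eq_iff]; tauto) h1 h2
      rcases Sym2.mem_iff.1 hv1 with rfl | rfl <;> simp
  · rintro (rfl | rfl)
    · exact ⟨(D.isPlaneArc_edgeArc hxy).left_mem, Or.inr (D.isPlaneArc_edgeArc hzx).right_mem⟩
    · exact ⟨(D.isPlaneArc_edgeArc hxy).right_mem, Or.inl (D.isPlaneArc_edgeArc hyz).left_mem⟩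

theorem tri_eq (x y z : V) :
    D.tri x y z = D.edgeArc s(x, y) ∪ (D.edgeArc s(y, z) ∪ D.edgeArc s(z, x)) := by
  rw [tri, Set.union_assoc]

/-- The complement of a triangle has at least two components, stated as: for every point `w`
there is a component that does not contain it. -/
theorem exists_notMem_connectedComponentIn_compl_tri {x y z : V} (hxy : G.Adj x y)
    (hyz : G.Adj y z) (hzx : G.Adj z x) (w : ℂ) :
    ∃ v, v ∉ D.tri x y z ∧ w ∉ connectedComponentIn (D.tri x y z)ᶜ v := by
  by_contra! hcon
  obtain ⟨v, hv⟩ : (D.tri x y z)ᶜ.Nonempty := by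
    rw [Set.nonempty_compl]
    intro h
    exact noncompact_univ ℂ (h ▸ D.isCompact_tri x y z)
  have hc : IsPreconnected (D.tri x y z)ᶜ := by
    have : (D.tri x y z)ᶜ = connectedComponentIn (D.tri x y z)ᶜ w := by
      refine Set.Subset.antisymm (fun u hu => ?_) (connectedComponentIn_subset _ _)
      rw [← connectedComponentIn_eq (hcon u hu)]
      exact mem_connectedComponentIn hu
    rw [this]
    exact isPreconnected_connectedComponentIn
  have hl1 : LogRel (D.edgeArc s(x, y))ᶜ (D.point x) (D.point y) :=
    (D.isPlaneArc_edgeArc hxy).logRel disjoint_compl_right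
  have hl2 : LogRel (D.edgeArc s(y, z) ∪ D.edgeArc s(z, x))ᶜ (D.point x) (D.point y) :=
    (((D.isPlaneArc_edgeArc hyz).logRel (disjoint_compl_right.mono_right
      (Set.compl_subset_compl.2 Set.subset_union_left))).trans
      ((D.isPlaneArc_edgeArc hzx).logRel (disjoint_compl_right.mono_right
      (Set.compl_subset_compl.2 Set.subset_union_right)))).symm
  rw [tri_eq] at hc hv
  exact not_isPreconnected_compl_union (D.isClosed_edgeArc _)
    ((D.isClosed_edgeArc _).union (D.isClosed_edgeArc _)) (D.point_injective.ne hxy.ne)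
    (D.edgeArc_inter_union hxy hyz hzx) hl1 hl2 ⟨v, hv⟩ hc

/-- The complement of a triangle has at most two components. -/
theorem mem_connectedComponentIn_compl_tri {x y z : V} (hxy : G.Adj x y)
    (hyz : G.Adj y z) (hzx : G.Adj z x) {p q r : ℂ} (hp : p ∉ D.tri x y z)
    (hq : q ∉ D.tri x y z) (hr : r ∉ D.tri x y z) :
    q ∈ connectedComponentIn (D.tri x y z)ᶜ p ∨ r ∈ connectedComponentIn (D.tri x y z)ᶜ p ∨
      r ∈ connectedComponentIn (D.tri x y z)ᶜ q := by
  rw [tri_eq, Set.union_comm] at *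
  have hl := D.hasLogs_edgeArc_union hxy hyz hzx
  have hB := (D.isCompact_edgeArc s(y, z)).union (D.isCompact_edgeArc s(z, x))
  rw [Set.mem_union, not_or] at hp hq hr
  exact mem_connectedComponentIn_union_arc hB (D.isCompact_edgeArc _)
    (D.isPlaneArc_edgeArc hxy).hasLogs (D.edgeArc_inter_union hxy hyz hzx) hp.2 hq.2 hr.2
    (hl.mem_connectedComponentIn hB hp.1 hq.1) (hl.mem_connectedComponentIn hB hp.1 hr.1)

/-- The boundary of a component of the complement of a triangle contains inner points of every
side: otherwise the component would be the whole complement of the two other sides. -/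
theorem exists_mem_frontier_connectedComponentIn_compl_tri {x y z : V} (hxy : G.Adj x y)
    (hyz : G.Adj y z) (hzx : G.Adj z x) {v : ℂ} (hv : v ∉ D.tri x y z) :
    ∃ w ∈ D.edgeArc s(x, y) \ Set.range D.point,
      w ∈ frontier (connectedComponentIn (D.tri x y z)ᶜ v) := by
  by_contra! hcon
  set P := connectedComponentIn (D.tri x y z)ᶜ v with hP
  have hcl := (D.isCompact_tri x y z).isClosed
  have hB := (D.isCompact_edgeArc s(y, z)).union (D.isCompact_edgeArc s(z, x))
  have hfr : frontier P ⊆ D.edgeArc s(y, z) ∪ D.edgeArc s(z, x) := by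
    intro w hw
    rcases (D.tri_eq x y z) ▸ frontier_connectedComponentIn_subset hcl v hw with h | h
    · by_cases hwr : w ∈ Set.range D.point
      · obtain ⟨u, rfl⟩ := hwr
        rcases Sym2.mem_iff.1 (D.mem_of_point_mem_edgeArc h) with rfl | rfl
        · exact Or.inr (D.isPlaneArc_edgeArc hzx).right_mem
        · exact Or.inl (D.isPlaneArc_edgeArc hyz).left_mem
      · exact absurd hw (hcon w ⟨h, hwr⟩)
    · exact h
  have hPT : P ⊆ (D.tri x y z)ᶜ := connectedComponentIn_subset _ _
  have hvP : v ∈ P := mem_connectedComponentIn hv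
  have heq := eq_connectedComponentIn_of_frontier_subset hcl.isOpen_compl.connectedComponentIn
    isPreconnected_connectedComponentIn (Set.disjoint_left.2 fun w hw hwB => hPT hw (by
      rw [tri_eq]; exact Or.inr hwB)) hfr hvP
  obtain ⟨w, hw, hwx, hwy⟩ := (D.isPlaneArc_edgeArc hxy).exists_mem_ne
  have hwB : w ∉ D.edgeArc s(y, z) ∪ D.edgeArc s(z, x) := fun h => by
    have : w ∈ ({D.point x, D.point y} : Set ℂ) := D.edgeArc_inter_union hxy hyz hzx ▸ ⟨hw, h⟩
    rcases this with rfl | rfl <;> contradiction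
  have hwP : w ∈ P := by
    rw [hP, heq]
    exact (D.hasLogs_edgeArc_union hxy hyz hzx).mem_connectedComponentIn hB
      (fun h => hv (by rw [tri_eq]; exact Or.inr h)) hwB
  exact hPT hwP (D.edgeArc_subset_tri x y z hw)

/-! ### Faces -/

variable {D}

theorem isFace_connectedComponentIn {z : ℂ} (hz : z ∉ D.carrier) :
    D.IsFace (connectedComponentIn D.carrierᶜ z) := ⟨z, hz, rfl⟩

theorem IsFace.isOpen [Finite V] {F : Set ℂ} (hF : D.IsFace F) : IsOpen F := by
  obtain ⟨z, -, rfl⟩ := hF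
  exact D.isCompact_carrier.isClosed.isOpen_compl.connectedComponentIn

theorem IsFace.isPreconnected {F : Set ℂ} (hF : D.IsFace F) : IsPreconnected F := by
  obtain ⟨z, -, rfl⟩ := hF
  exact isPreconnected_connectedComponentIn

theorem IsFace.nonempty {F : Set ℂ} (hF : D.IsFace F) : F.Nonempty := by
  obtain ⟨z, hz, rfl⟩ := hF
  exact ⟨z, mem_connectedComponentIn hz⟩

theorem IsFace.disjoint_carrier {F : Set ℂ} (hF : D.IsFace F) : Disjoint F D.carrier := by
  obtain ⟨z, -, rfl⟩ := hF
  exact Set.disjoint_left.2 fun _ h => connectedComponentIn_subset _ _ h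

theorem IsFace.eq_connectedComponentIn {F : Set ℂ} (hF : D.IsFace F) {w : ℂ} (hw : w ∈ F) :
    F = connectedComponentIn D.carrierᶜ w := by
  obtain ⟨z, -, rfl⟩ := hF
  exact connectedComponentIn_eq hw

theorem IsFace.mem_frontier [Finite V] {F : Set ℂ} (hF : D.IsFace F) {w : ℂ}
    (hw : w ∈ closure F) (hwK : w ∈ D.carrier) : w ∈ frontier F := by
  rw [hF.isOpen.frontier_eq]
  exact ⟨hw, fun h => Set.disjoint_left.1 hF.disjoint_carrier h hwK⟩

theorem IsFace.eq_connectedComponentIn_compl_tri [Finite V] {F : Set ℂ} (hF : D.IsFace F)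
    {x y z : V} (hfr : frontier F = D.tri x y z) {w : ℂ} (hw : w ∈ F) :
    F = connectedComponentIn (D.tri x y z)ᶜ w :=
  eq_connectedComponentIn_of_frontier_subset hF.isOpen hF.isPreconnected
    (hF.disjoint_carrier.mono_right (D.tri_subset_carrier x y z)) hfr.le hw

/-- An edge is on the boundary of at most two faces: removing its inner points from the drawing
merges all faces along it into one, which the edge splits into at most two. -/
theorem eq_of_isFace_of_edgeArc_subset_frontier [Finite V] {x y : V} (hxy : G.Adj x y)
    {F₁ F₂ F₃ : Set ℂ} (h₁ : D.IsFace F₁) (h₂ : D.IsFace F₂) (h₃ : D.IsFace F₃)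
    (f₁ : D.edgeArc s(x, y) ⊆ frontier F₁) (f₂ : D.edgeArc s(x, y) ⊆ frontier F₂)
    (f₃ : D.edgeArc s(x, y) ⊆ frontier F₃) : F₁ = F₂ ∨ F₁ = F₃ ∨ F₂ = F₃ := by
  let A := D.edgeArc s(x, y)
  let K := Set.range D.point ∪ ⋃ e ∈ {e | e ≠ s(x, y)}, D.edgeArc e
  have hK : IsCompact K := (Set.finite_range _).isCompact.union
    ((Set.toFinite _).isCompact_biUnion fun e _ => D.isCompact_edgeArc e)
  have hA := D.isPlaneArc_edgeArc hxy
  have hKA : K ∪ A = D.carrier := by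
    rw [carrier_eq]
    ext w
    simp only [K, A, Set.mem_union, Set.mem_iUnion]
    constructor
    · rintro ((h | ⟨e, -, h⟩) | h)
      exacts [Or.inl h, Or.inr ⟨e, h⟩, Or.inr ⟨_, h⟩]
    · rintro (h | ⟨e, h⟩)
      · exact Or.inl (Or.inl h)
      · by_cases he : e = s(x, y)
        · exact Or.inr (he ▸ h)
        · exact Or.inl (Or.inr ⟨e, he, h⟩)
  have hAr : ∀ w ∈ A, w ∈ K → w ∈ Set.range D.point := by
    rintro w hw (h | h)
    · exact h
    · obtain ⟨e, he, h⟩ := Set.mem_iUnion₂.1 h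
      exact D.edgeArc_inter_edgeArc he ⟨h, hw⟩
  have hAK : A ∩ K = {D.point x, D.point y} := by
    ext w
    constructor
    · rintro ⟨hw, hwK⟩
      obtain ⟨v, rfl⟩ := hAr w hw hwK
      rcases Sym2.mem_iff.1 (D.mem_of_point_mem_edgeArc hw) with rfl | rfl <;> simp
    · rintro (rfl | rfl)
      · exact ⟨hA.left_mem, Or.inl (Set.mem_range_self _)⟩
      · exact ⟨hA.right_mem, Or.inl (Set.mem_range_self _)⟩
  -- An inner point `w` of the edge connects the faces in the complement of the rest `K`.
  obtain ⟨w, hw, hwx, hwy⟩ := hA.exists_mem_ne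
  have hwK : w ∉ K := fun h => by
    have : w ∈ ({D.point x, D.point y} : Set ℂ) := hAK ▸ ⟨hw, h⟩
    rcases this with rfl | rfl <;> contradiction
  obtain ⟨p₁, hp₁⟩ := h₁.nonempty
  obtain ⟨p₂, hp₂⟩ := h₂.nonempty
  obtain ⟨p₃, hp₃⟩ := h₃.nonempty
  have hdis : ∀ {F : Set ℂ}, D.IsFace F → ∀ p ∈ F, p ∉ K ∧ p ∉ A := fun hF p hp => by
    have : p ∉ K ∪ A := hKA ▸ Set.disjoint_left.1 hF.disjoint_carrier hp
    simpa using this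
  have hcomp : ∀ {F : Set ℂ}, D.IsFace F → A ⊆ frontier F → ∀ p ∈ F,
      connectedComponentIn Kᶜ p = connectedComponentIn Kᶜ w := fun {F} hF hfr p hp => by
    have hc : IsPreconnected (insert w F) :=
      hF.isPreconnected.subset_closure (Set.subset_insert _ _)
        (Set.insert_subset (frontier_subset_closure (hfr hw)) subset_closure)
    refine (connectedComponentIn_eq (hc.subset_connectedComponentIn (Set.mem_insert w F) ?_
      (Set.mem_insert_of_mem _ hp))).symm
    exact Set.insert_subset hwK fun u hu => (hdis hF u hu).1
  have hmem : ∀ {F : Set ℂ}, D.IsFace F → A ⊆ frontier F → ∀ p ∈ F,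
      p ∈ connectedComponentIn Kᶜ p₁ := fun hF hfr p hp => by
    rw [hcomp h₁ f₁ p₁ hp₁, ← hcomp hF hfr p hp]
    exact mem_connectedComponentIn (hdis hF p hp).1
  have := mem_connectedComponentIn_union_arc hK hA.isCompact hA.hasLogs hAK
    (hdis h₁ p₁ hp₁).2 (hdis h₂ p₂ hp₂).2 (hdis h₃ p₃ hp₃).2 (hmem h₂ f₂ p₂ hp₂)
    (hmem h₃ f₃ p₃ hp₃)
  rw [hKA] at this
  rw [h₁.eq_connectedComponentIn hp₁, h₂.eq_connectedComponentIn hp₂,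
    h₃.eq_connectedComponentIn hp₃]
  rcases this with h | h | h
  · exact Or.inl (connectedComponentIn_eq h)
  · exact Or.inr (Or.inl (connectedComponentIn_eq h))
  · exact Or.inr (Or.inr (connectedComponentIn_eq h))

end PlaneDrawing

/-! ### Drawings whose faces are enclosed by three edges -/

namespace PlaneDrawing

variable {V : Type*} {G : SimpleGraph V} {D : PlaneDrawing G}

theorem IsEnclosedByThreeEdges.exists_tri {F : Set ℂ} (hF : D.IsEnclosedByThreeEdges F) :
    ∃ x y z, G.Adj x y ∧ G.Adj y z ∧ G.Adj z x ∧ frontier F = D.tri x y z := by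
  obtain ⟨x, y, z, hxy, hyz, hzx, h⟩ := hF
  refine ⟨x, y, z, hxy, hyz, hzx, ?_⟩
  rw [h, tri, D.edgeArc_eq (G.mem_edgeSet.2 hxy), D.edgeArc_eq (G.mem_edgeSet.2 hyz),
    D.edgeArc_eq (G.mem_edgeSet.2 hzx)]

/-- An inner point of an edge is on the boundary of a face only if that edge is one of the three
edges enclosing the face. -/
theorem IsEnclosedByThreeEdges.exists_tri_of_mem {F : Set ℂ} (hF : D.IsEnclosedByThreeEdges F)
    {x y : V} {w : ℂ} (hw : w ∈ D.edgeArc s(x, y)) (hwr : w ∉ Set.range D.point)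
    (hwF : w ∈ frontier F) : ∃ z, G.Adj y z ∧ G.Adj z x ∧ frontier F = D.tri x y z := by
  obtain ⟨u, v, t, huv, hvt, htu, h⟩ := hF.exists_tri
  have key : ∀ {u v t : V}, G.Adj u v → G.Adj v t → G.Adj t u → frontier F = D.tri u v t →
      w ∈ D.edgeArc s(u, v) → ∃ z, G.Adj y z ∧ G.Adj z x ∧ frontier F = D.tri x y z := by
    intro u v t huv hvt htu h hwe
    by_cases he : s(x, y) = s(u, v)
    · rcases Sym2.eq_iff.1 he with ⟨rfl, rfl⟩ | ⟨rfl, rfl⟩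
      · exact ⟨t, hvt, htu, h⟩
      · exact ⟨t, htu.symm, hvt.symm, by rw [h, D.tri_swap]⟩
    · exact absurd (D.edgeArc_inter_edgeArc he ⟨hw, hwe⟩) hwr
  rcases h ▸ hwF with (hwe | hwe) | hwe
  · exact key huv hvt htu h hwe
  · exact key hvt htu huv (by rw [h, D.tri_rotate]) hwe
  · exact key htu huv hvt (by rw [h, D.tri_rotate, D.tri_rotate]) hwe

variable [Finite V] (hD : ∀ F, D.IsFace F → D.IsEnclosedByThreeEdges F)
include hD

/-- There are finitely many triangles, and each is the boundary of at most two faces. -/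
theorem finite_setOf_isFace : {F | D.IsFace F}.Finite := by
  have : {F | D.IsFace F} ⊆ ⋃ t : V × V × V,
      {F | D.IsFace F ∧ G.Adj t.1 t.2.1 ∧ G.Adj t.2.1 t.2.2 ∧ G.Adj t.2.2 t.1 ∧
        frontier F = D.tri t.1 t.2.1 t.2.2} := by
    intro F hF
    obtain ⟨x, y, z, h⟩ := (hD F hF).exists_tri
    exact Set.mem_iUnion.2 ⟨(x, y, z), hF, h⟩
  refine (Set.finite_iUnion fun t => ?_).subset this
  obtain ⟨x, y, z⟩ := t
  by_contra hinf
  obtain ⟨S, hS, hcard⟩ := Set.Infinite.exists_subset_card_eq hinf 3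
  obtain ⟨F₁, F₂, F₃, h12, h13, h23, rfl⟩ := Finset.card_eq_three.1 hcard
  obtain ⟨h₁, hxy, hyz, hzx, f₁⟩ := hS (show F₁ ∈ _ by simp)
  obtain ⟨h₂, -, -, -, f₂⟩ := hS (show F₂ ∈ _ by simp)
  obtain ⟨h₃, -, -, -, f₃⟩ := hS (show F₃ ∈ _ by simp)
  rcases eq_of_isFace_of_edgeArc_subset_frontier hxy h₁ h₂ h₃
    (f₁ ▸ D.edgeArc_subset_tri x y z) (f₂ ▸ D.edgeArc_subset_tri x y z)
    (f₃ ▸ D.edgeArc_subset_tri x y z) with h | h | h <;> contradiction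

/-- As there are finitely many faces, a limit of points of faces is in the closure of one of those
faces. -/
theorem exists_isFace_mem_closure {Q : Set ℂ} {z : ℂ} (hz : z ∈ closure (Q ∩ D.carrierᶜ)) :
    ∃ F, D.IsFace F ∧ z ∈ closure F ∧ (F ∩ Q).Nonempty := by
  have hsub : Q ∩ D.carrierᶜ ⊆ ⋃ F ∈ {F | D.IsFace F ∧ (F ∩ Q).Nonempty}, F := by
    rintro w ⟨hwQ, hw⟩
    exact Set.mem_iUnion₂.2 ⟨_, ⟨isFace_connectedComponentIn hw,
      w, mem_connectedComponentIn hw, hwQ⟩, mem_connectedComponentIn hw⟩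
  have hfin : {F | D.IsFace F ∧ (F ∩ Q).Nonempty}.Finite :=
    (finite_setOf_isFace hD).subset fun F hF => hF.1
  have := closure_mono hsub hz
  rw [hfin.closure_biUnion] at this
  obtain ⟨F, hF, hzF⟩ := Set.mem_iUnion₂.1 this
  exact ⟨F, hF.1, hzF, hF.2⟩

/-- On either side of a triangle, every side of the triangle bounds a face. -/
theorem exists_isFace_subset_connectedComponentIn_compl_tri {x y z : V} (hxy : G.Adj x y)
    (hyz : G.Adj y z) (hzx : G.Adj z x) {v : ℂ} (hv : v ∉ D.tri x y z) :
    ∃ F, D.IsFace F ∧ F ⊆ connectedComponentIn (D.tri x y z)ᶜ v ∧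
      ∃ t, G.Adj y t ∧ G.Adj t x ∧ frontier F = D.tri x y t := by
  obtain ⟨w, ⟨hw, hwr⟩, hwP⟩ :=
    D.exists_mem_frontier_connectedComponentIn_compl_tri hxy hyz hzx hv
  set P := connectedComponentIn (D.tri x y z)ᶜ v
  have hPo : IsOpen P := (D.isCompact_tri x y z).isClosed.isOpen_compl.connectedComponentIn
  have hwc : w ∈ closure (P ∩ D.carrierᶜ) :=
    closure_minimal (D.dense_compl_carrier.open_subset_closure_inter hPo) isClosed_closure
      (frontier_subset_closure hwP)
  obtain ⟨F, hF, hwF, u, huF, huP⟩ := exists_isFace_mem_closure hD hwc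
  refine ⟨F, hF, ?_, (hD F hF).exists_tri_of_mem hw hwr
    (hF.mem_frontier hwF (D.edgeArc_subset_carrier _ hw))⟩
  rw [show P = connectedComponentIn (D.tri x y z)ᶜ u from connectedComponentIn_eq huP]
  exact hF.isPreconnected.subset_connectedComponentIn huF fun t ht htT =>
    Set.disjoint_left.1 hF.disjoint_carrier ht (D.tri_subset_carrier x y z htT)

/-- The drawing has no inner points, so every vertex is on the boundary of a face. -/
theorem exists_triangle_of_vertex (v : V) : ∃ x y, G.Adj v x ∧ G.Adj x y ∧ G.Adj y v := by
  obtain ⟨F, hF, hv, -⟩ := exists_isFace_mem_closure hD (Q := Set.univ) (z := D.point v)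
    (by rw [Set.univ_inter]; exact D.dense_compl_carrier _)
  obtain ⟨x, y, z, hxy, hyz, hzx, h⟩ := (hD F hF).exists_tri
  have := h ▸ hF.mem_frontier hv (D.point_mem_carrier v)
  rcases D.mem_of_point_mem_tri this with rfl | rfl | rfl
  exacts [⟨y, z, hxy, hyz, hzx⟩, ⟨z, x, hyz, hzx, hxy⟩, ⟨x, y, hzx, hxy, hyz⟩]

omit [Finite V] hD in
theorem eq_of_tri_eq {x y z t : V} (hyz : G.Adj y z) (hzx : G.Adj z x) (hyt : G.Adj y t)
    (htx : G.Adj t x) (h : D.tri x y z = D.tri x y t) : z = t := by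
  have : D.point z ∈ D.tri x y t := by
    rw [← h]; exact Or.inl (Or.inr (D.isPlaneArc_edgeArc hyz).right_mem)
  rcases D.mem_of_point_mem_tri this with rfl | rfl | rfl
  exacts [absurd rfl hzx.ne, absurd rfl hyz.ne, rfl]

/-- If `a` and `b` are alike, then every triangle through `a` bounds a face, on its side away from
`b`: a neighbor `t` of `a` strictly inside that side would be joined to `b` by an edge that avoids
the triangle. -/
theorem exists_isFace_frontier_eq_tri {a b x y : V} (hab : a ≠ b) (hal : Alike G a b)
    (hax : G.Adj a x) (hxy : G.Adj x y) (hya : G.Adj y a) :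
    ∃ F, D.IsFace F ∧ frontier F = D.tri a x y := by
  have hN : ∀ v, G.Adj a v ↔ G.Adj b v := fun v => Set.ext_iff.1 hal v
  obtain ⟨v, hv, hbv⟩ :=
    D.exists_notMem_connectedComponentIn_compl_tri hax hxy hya (D.point b)
  obtain ⟨F, hF, hFP, t, hxt, hta, hfr⟩ :=
    exists_isFace_subset_connectedComponentIn_compl_tri hD hax hxy hya hv
  refine ⟨F, hF, ?_⟩
  by_cases hty : t = y
  · rw [hfr, hty]
  exfalso
  have hbt : G.Adj b t := (hN t).1 hta.symm
  have hdis : D.edgeArc s(b, t) ⊆ (D.tri a x y)ᶜ := by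
    have n1 := hta.ne
    have n2 := hxt.ne
    have n3 := ((hN x).1 hax).ne
    have n4 := ((hN y).1 hya.symm).ne
    rintro w hw ((h | h) | h) <;>
    · obtain ⟨u, rfl, hu1, hu2⟩ := D.exists_mem_of_mem_edgeArc_inter (by
        simp only [ne_eq, Sym2.eq_iff]; tauto) hw h
      rw [Sym2.mem_iff] at hu1 hu2
      rcases hu1 with rfl | rfl <;> tauto
  have harc := D.isPlaneArc_edgeArc hbt
  have htF : D.point t ∈ closure F := frontier_subset_closure (by
    rw [hfr]; exact Or.inr (D.isPlaneArc_edgeArc hta).left_mem)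
  have htP : D.point t ∈ connectedComponentIn (D.tri a x y)ᶜ v :=
    closure_connectedComponentIn_inter (D.isCompact_tri a x y).isClosed.isOpen_compl v
      ⟨closure_mono hFP htF, hdis harc.right_mem⟩
  rw [connectedComponentIn_eq htP] at hbv
  exact hbv (harc.isPreconnected.subset_connectedComponentIn harc.right_mem hdis harc.left_mem)

/-- In the graph induced on the common neighbors of two alike vertices, degrees are 0 or 2: each of
the two faces at the edge `a x` provides one neighbor of `x`, and every neighbor arises so. -/
theorem ncard_adj_eq_two {a b x y : V} (hab : a ≠ b) (hal : Alike G a b)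
    (hax : G.Adj a x) (hxy : G.Adj x y) (hya : G.Adj y a) :
    {y | G.Adj x y ∧ G.Adj a y}.ncard = 2 := by
  have hN : ∀ v, G.Adj a v ↔ G.Adj b v := fun v => Set.ext_iff.1 hal v
  obtain ⟨v₁, hv₁, -⟩ :=
    D.exists_notMem_connectedComponentIn_compl_tri hax hxy hya (D.point b)
  obtain ⟨v₂, hv₂, hv₁₂⟩ := D.exists_notMem_connectedComponentIn_compl_tri hax hxy hya v₁
  obtain ⟨F₁, h₁, hF₁, y₁, hxy₁, hya₁, f₁⟩ :=
    exists_isFace_subset_connectedComponentIn_compl_tri hD hax hxy hya hv₁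
  obtain ⟨F₂, h₂, hF₂, y₂, hxy₂, hya₂, f₂⟩ :=
    exists_isFace_subset_connectedComponentIn_compl_tri hD hax hxy hya hv₂
  obtain ⟨p₁, hp₁⟩ := h₁.nonempty
  obtain ⟨p₂, hp₂⟩ := h₂.nonempty
  have hF₁₂ : F₁ ≠ F₂ := by
    rintro rfl
    refine hv₁₂ ?_
    rw [connectedComponentIn_eq (hF₂ hp₁), ← connectedComponentIn_eq (hF₁ hp₁)]
    exact mem_connectedComponentIn hv₁
  have hy₁₂ : y₁ ≠ y₂ := by
    rintro rfl
    -- Both sides of the triangle `a x y₁` would be faces, which leaves no room for `b`.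
    have hbT : D.point b ∉ D.tri a x y₁ := fun h => by
      rcases D.mem_of_point_mem_tri h with rfl | rfl | rfl
      exacts [hab rfl, ((hN b).1 hax).ne rfl, ((hN b).1 hya₁.symm).ne rfl]
    have e₁ := h₁.eq_connectedComponentIn_compl_tri f₁ hp₁
    have e₂ := h₂.eq_connectedComponentIn_compl_tri f₂ hp₂
    have hK : ∀ {F : Set ℂ}, D.IsFace F → ∀ p ∈ F, p ∉ D.tri a x y₁ := fun hF p hp h =>
      Set.disjoint_left.1 hF.disjoint_carrier hp (D.tri_subset_carrier _ _ _ h)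
    have hb : ∀ {F : Set ℂ}, D.IsFace F → D.point b ∉ F := fun hF h =>
      Set.disjoint_left.1 hF.disjoint_carrier h (D.point_mem_carrier b)
    rcases D.mem_connectedComponentIn_compl_tri hax hxy₁ hya₁ (hK h₁ p₁ hp₁) (hK h₂ p₂ hp₂) hbT
      with h | h | h
    · exact hF₁₂ (by rw [e₁, e₂, connectedComponentIn_eq h])
    · exact hb h₁ (e₁ ▸ h)
    · exact hb h₂ (e₂ ▸ h)
  rw [Set.ncard_eq_two]
  refine ⟨y₁, y₂, hy₁₂, ?_⟩
  ext t
  constructor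
  · rintro ⟨hxt, hat⟩
    obtain ⟨F, hF, hfr⟩ := exists_isFace_frontier_eq_tri hD hab hal hax hxt hat.symm
    rcases eq_of_isFace_of_edgeArc_subset_frontier hax h₁ h₂ hF
      (f₁ ▸ D.edgeArc_subset_tri _ _ _) (f₂ ▸ D.edgeArc_subset_tri _ _ _)
      (hfr ▸ D.edgeArc_subset_tri _ _ _) with h | h | h
    · exact absurd h hF₁₂
    · exact Or.inl (eq_of_tri_eq hxt hat.symm hxy₁ hya₁ (by rw [← hfr, ← f₁, h]))
    · exact Or.inr (eq_of_tri_eq hxt hat.symm hxy₂ hya₂ (by rw [← hfr, ← f₂, h]))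
  · rintro (rfl | rfl)
    · exact ⟨hxy₁, hya₁.symm⟩
    · exact ⟨hxy₂, hya₂.symm⟩

/-- The only faces at an edge `x y` between common neighbors are those bounded by `a x y` and by
`b x y`. -/
theorem eq_or_eq_of_frontier_eq_tri {a b x y t : V} (hab : a ≠ b) (hal : Alike G a b)
    (hax : G.Adj a x) (hxy : G.Adj x y) (hya : G.Adj y a) {F : Set ℂ} (hF : D.IsFace F)
    (hyt : G.Adj y t) (htx : G.Adj t x) (hfr : frontier F = D.tri x y t) : t = a ∨ t = b := by
  have hN : ∀ v, G.Adj a v ↔ G.Adj b v := fun v => Set.ext_iff.1 hal v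
  have hbx := (hN x).1 hax
  have hby := (hN y).1 hya.symm
  obtain ⟨Fa, ha, fa⟩ := exists_isFace_frontier_eq_tri hD hab hal hax hxy hya
  obtain ⟨Fb, hb, fb⟩ := exists_isFace_frontier_eq_tri hD hab.symm hal.symm hbx hxy hby.symm
  rw [D.tri_rotate] at fa fb
  rcases eq_of_isFace_of_edgeArc_subset_frontier hxy ha hb hF
    (fa ▸ D.edgeArc_subset_tri _ _ _) (fb ▸ D.edgeArc_subset_tri _ _ _)
    (hfr ▸ D.edgeArc_subset_tri _ _ _) with h | h | h
  · exact absurd (eq_of_tri_eq hya hax hby.symm hbx (by rw [← fa, ← fb, h])) hab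
  · exact Or.inl (eq_of_tri_eq hyt htx hya hax (by rw [← fa, ← hfr, h]))
  · exact Or.inr (eq_of_tri_eq hyt htx hby.symm hbx (by rw [← fb, ← hfr, h]))

/-- Let `C` be a nonempty set of common neighbors of `a` and `b`, without isolated vertices and
closed under adjacency among the neighbors of `a`. The closed faces at `a` or `b` with their two
other vertices in `C` then cover the plane: away from the finitely many vertices, their union is
open and closed. Hence there are no vertices other than `a`, `b` and those in `C`. -/
theorem eq_or_eq_or_mem_of_closed {a b : V} (hab : a ≠ b) (hal : Alike G a b) {C : Set V}
    (hCa : ∀ x ∈ C, G.Adj a x) (hC : ∀ x ∈ C, ∀ y, G.Adj a y → G.Adj x y → y ∈ C)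
    {x₀ y₀ : V} (hx₀ : x₀ ∈ C) (hy₀ : y₀ ∈ C) (hxy₀ : G.Adj x₀ y₀) (v : V) :
    v = a ∨ v = b ∨ v ∈ C := by
  have hN : ∀ v, G.Adj a v ↔ G.Adj b v := fun v => Set.ext_iff.1 hal v
  let S : Set (Set ℂ) := {F | D.IsFace F ∧ ∃ c x y, (c = a ∨ c = b) ∧ x ∈ C ∧ y ∈ C ∧
    G.Adj x y ∧ frontier F = D.tri c x y}
  have hSfin : S.Finite := (finite_setOf_isFace hD).subset fun F hF => hF.1
  let X : Set ℂ := ⋃ F ∈ S, closure F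
  have hXc : IsClosed X := hSfin.isClosed_biUnion fun F _ => isClosed_closure
  have hca : ∀ c, (c = a ∨ c = b) → ∀ v, G.Adj c v ↔ G.Adj a v := by
    rintro c (rfl | rfl) v
    exacts [Iff.rfl, (hN v).symm]
  -- Every face that touches `X` in a point other than a vertex belongs to `S`.
  have hclosed : ∀ z ∈ X, z ∉ Set.range D.point → ∀ F, D.IsFace F → z ∈ closure F → F ∈ S := by
    intro z hz hzr F hF hzF
    obtain ⟨F', ⟨hF', c, x, y, hc, hx, hy, hxy, hfr⟩, hzF'⟩ := Set.mem_iUnion₂.1 hz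
    by_cases hzK : z ∈ D.carrier
    · have hz1 := hF.mem_frontier hzF hzK
      have hz2 := hfr ▸ hF'.mem_frontier hzF' hzK
      have hcx : G.Adj c x := (hca c hc x).2 (hCa x hx)
      have hcy : G.Adj c y := (hca c hc y).2 (hCa y hy)
      rcases hz2 with (h | h) | h
      · obtain ⟨t, hxt, htc, hft⟩ := (hD F hF).exists_tri_of_mem h hzr hz1
        exact ⟨hF, c, x, t, hc, hx, hC x hx t ((hca c hc t).1 htc.symm) hxt, hxt, hft⟩
      · obtain ⟨t, hyt, htx, hft⟩ := (hD F hF).exists_tri_of_mem h hzr hz1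
        refine ⟨hF, t, x, y, ?_, hx, hy, hxy, by rw [hft, ← D.tri_rotate]⟩
        exact eq_or_eq_of_frontier_eq_tri hD hab hal (hCa x hx) hxy (hCa y hy).symm hF hyt htx hft
      · obtain ⟨t, hct, hty, hft⟩ := (hD F hF).exists_tri_of_mem h hzr hz1
        exact ⟨hF, c, t, y, hc, hC y hy t ((hca c hc t).1 hct) hty.symm, hy, hty,
          by rw [hft, D.tri_rotate]⟩
    · have : F = F' := by
        have hzc : z ∈ D.carrierᶜ := hzK
        have hop := D.isCompact_carrier.isClosed.isOpen_compl
        have key : ∀ {F : Set ℂ}, D.IsFace F → z ∈ closure F → z ∈ F := by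
          rintro _ ⟨u, -, rfl⟩ h
          exact closure_connectedComponentIn_inter hop u ⟨h, hzc⟩
        rw [hF.eq_connectedComponentIn (key hF hzF), hF'.eq_connectedComponentIn (key hF' hzF')]
      exact this ▸ ⟨hF', c, x, y, hc, hx, hy, hxy, hfr⟩
  have hXo : ∀ z ∈ X, z ∉ Set.range D.point → z ∈ interior X := by
    intro z hz hzr
    -- The complement of the other closed faces is a neighborhood of `z` inside `X`.
    let W : Set ℂ := ⋃ F ∈ {F | D.IsFace F ∧ F ∉ S}, closure F
    have hW : IsClosed W := ((finite_setOf_isFace hD).subset fun F hF => hF.1).isClosed_biUnion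
      fun F _ => isClosed_closure
    refine mem_interior.2 ⟨Wᶜ, fun w hw => ?_, hW.isOpen_compl, fun hzW => ?_⟩
    · have hwc := D.dense_compl_carrier.open_subset_closure_inter hW.isOpen_compl hw
      refine closure_minimal ?_ hXc hwc
      rintro u ⟨huW, huK⟩
      have hu := isFace_connectedComponentIn huK
      have huu := subset_closure (mem_connectedComponentIn huK)
      by_contra huX
      refine huW (Set.mem_iUnion₂.2 ⟨_, ⟨hu, fun huS => huX ?_⟩, huu⟩)
      exact Set.mem_iUnion₂.2 ⟨_, huS, huu⟩
    · obtain ⟨F, ⟨hF, hFS⟩, hzF⟩ := Set.mem_iUnion₂.1 hzW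
      exact hFS (hclosed z hz hzr F hF hzF)
  have hcount : (Set.range D.point).Countable := (Set.finite_range _).countable
  have hcon : IsPreconnected (Set.range D.point)ᶜ :=
    (hcount.isConnected_compl_of_one_lt_rank (by simp)).isPreconnected
  have hXne : ((Set.range D.point)ᶜ ∩ interior X).Nonempty := by
    obtain ⟨F, hF, hfr⟩ :=
      exists_isFace_frontier_eq_tri hD hab hal (hCa x₀ hx₀) hxy₀ (hCa y₀ hy₀).symm
    obtain ⟨p, hp⟩ := hF.nonempty
    have hpr : p ∉ Set.range D.point := fun h =>
      Set.disjoint_left.1 hF.disjoint_carrier hp (Or.inl h)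
    exact ⟨p, hpr, hXo p (Set.mem_iUnion₂.2
      ⟨F, ⟨hF, a, x₀, y₀, Or.inl rfl, hx₀, hy₀, hxy₀, hfr⟩, subset_closure hp⟩) hpr⟩
  have hsub : (Set.range D.point)ᶜ ⊆ X :=
    (hcon.subset_of_closure_inter_subset isOpen_interior hXne fun z hz =>
      hXo z (hXc.closure_interior_subset hz.1) hz.2).trans interior_subset
  have hX : D.point v ∈ X :=
    closure_minimal hsub hXc (hcount.dense_compl ℝ _)
  obtain ⟨F, ⟨hF, c, x, y, hc, hx, hy, -, hfr⟩, hvF⟩ := Set.mem_iUnion₂.1 hX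
  rcases D.mem_of_point_mem_tri (hfr ▸ hF.mem_frontier hvF (D.point_mem_carrier v))
    with rfl | rfl | rfl
  · tauto
  · exact Or.inr (Or.inr hx)
  · exact Or.inr (Or.inr hy)

end PlaneDrawing

/-! ### Recognizing cycles and bipyramids -/

theorem SimpleGraph.ncard_neighborSet_cycleGraph {n : ℕ} (hn : 3 ≤ n) (i : Fin n) :
    ((SimpleGraph.cycleGraph n).neighborSet i).ncard = 2 := by
  obtain ⟨m, rfl⟩ := Nat.exists_eq_add_of_le' hn
  rw [← SimpleGraph.cycleGraph_degree_three_le (v := i), ← SimpleGraph.card_neighborSet_eq_degree,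
    ← Nat.card_eq_fintype_card]
  rfl

theorem SimpleGraph.IsCycles.exists_iso_cycleGraph {W : Type*} [Finite W] {H : SimpleGraph W}
    (hcyc : H.IsCycles) (hconn : H.Preconnected) {v w : W} (hvw : H.Adj v w) :
    ∃ n, 3 ≤ n ∧ Nonempty (SimpleGraph.cycleGraph n ≃g H) := by
  classical
  obtain ⟨p, hp, hpv⟩ := hcyc.exists_cycle_toSubgraph_verts_eq_connectedComponentSupp
    (c := H.connectedComponentMk v) rfl ⟨w, hvw⟩
  have h3 := hp.three_le_length
  obtain ⟨f⟩ := (SimpleGraph.cycleGraph_isContained_iff (G := H) h3).2 ⟨v, p, hp, rfl⟩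
  have hsupp : ∀ u, u ∈ p.support.tail := fun u => by
    have hu : u ∈ p.toSubgraph.verts := by
      rw [hpv]; exact SimpleGraph.ConnectedComponent.sound (hconn u v)
    rw [SimpleGraph.Walk.mem_verts_toSubgraph, SimpleGraph.Walk.mem_support_iff] at hu
    rcases hu with rfl | hu
    · exact SimpleGraph.Walk.end_mem_tail_support hp.not_nil
    · exact hu
  have hcard : Nat.card W = p.length := by
    have := Fintype.ofFinite W
    have huniv : p.support.tail.toFinset = Finset.univ :=
      Finset.eq_univ_of_forall fun u => List.mem_toFinset.2 (hsupp u)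
    rw [Nat.card_eq_fintype_card, ← Finset.card_univ, ← huniv,
      List.toFinset_card_of_nodup hp.support_nodup]
    simp
  have hbij : Function.Bijective f.toHom :=
    (Nat.bijective_iff_injective_and_card _).2 ⟨f.injective, by rw [hcard, Nat.card_fin]⟩
  refine ⟨p.length, h3, ⟨⟨Equiv.ofBijective _ hbij, ?_⟩⟩⟩
  intro i j
  refine ⟨fun hij => ?_, fun hij => f.toHom.map_adj hij⟩
  have hsub : f.toHom '' (SimpleGraph.cycleGraph p.length).neighborSet i ⊆
      H.neighborSet (f.toHom i) := by
    rintro _ ⟨k, hk, rfl⟩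
    exact f.toHom.map_adj hk
  have heq := Set.eq_of_subset_of_ncard_le hsub (by
    rw [Set.ncard_image_of_injective _ hbij.1,
      SimpleGraph.ncard_neighborSet_cycleGraph h3]
    exact (hcyc ⟨_, hij⟩).le)
  obtain ⟨k, hk, hkj⟩ : f.toHom j ∈ f.toHom '' (SimpleGraph.cycleGraph p.length).neighborSet i :=
    heq ▸ hij
  exact hbij.1 hkj ▸ hk

/-- The isomorphism from a bipyramid that is determined by two alike vertices `a` and `b` and a
cycle through all other vertices, each of which is a neighbor of `a`. -/
theorem exists_bipyramid_iso {V : Type*} {G : SimpleGraph V} {a b : V} (hab : a ≠ b)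
    (hal : Alike G a b) (hV : ∀ v, v = a ∨ v = b ∨ G.Adj a v) {n : ℕ}
    (f : SimpleGraph.cycleGraph n ≃g G.induce {v | G.Adj a v}) :
    ∃ φ : bipyramid n ≃g G, φ (Sum.inl 0) = a ∧ φ (Sum.inl 1) = b ∧
      Set.range (fun j : Fin n => φ (Sum.inr j)) = G.commonNeighbors a b := by
  have hN : ∀ v, G.Adj a v ↔ G.Adj b v := fun v => Set.ext_iff.1 hal v
  have hfa : ∀ j, G.Adj a (f j).1 := fun j => (f j).2
  have hfb : ∀ j, G.Adj b (f j).1 := fun j => (hN _).1 (f j).2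
  have hnab : ¬ G.Adj a b := fun h => G.irrefl ((hN b).1 h)
  let ψ : Fin 2 ⊕ Fin n → V := Sum.elim ![a, b] fun j => (f j).1
  have hψ : Function.Bijective ψ := by
    constructor
    · refine Function.Injective.sumElim ?_ (Subtype.val_injective.comp f.injective) ?_
      · intro i j hij
        fin_cases i <;> fin_cases j <;> simp_all
      · intro i j
        fin_cases i
        exacts [(hfa j).ne, (hfb j).ne]
    · intro v
      rcases hV v with rfl | rfl | h
      · exact ⟨Sum.inl 0, rfl⟩
      · exact ⟨Sum.inl 1, rfl⟩
      · obtain ⟨j, hj⟩ := f.surjective ⟨v, h⟩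
        exact ⟨Sum.inr j, congrArg Subtype.val hj⟩
  refine ⟨⟨Equiv.ofBijective ψ hψ, ?_⟩, rfl, rfl, ?_⟩
  · rintro (i | i) (j | j)
    · refine iff_of_false ?_ id
      fin_cases i <;> fin_cases j
      exacts [G.irrefl, hnab, fun h => hnab h.symm, G.irrefl]
    · refine iff_of_true ?_ trivial
      fin_cases i
      exacts [hfa j, hfb j]
    · refine iff_of_true ?_ trivial
      fin_cases j
      exacts [(hfa i).symm, (hfb i).symm]
    · exact f.map_adj_iff
  · ext v
    rw [SimpleGraph.mem_commonNeighbors]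
    constructor
    · rintro ⟨j, rfl⟩
      exact ⟨hfa j, hfb j⟩
    · rintro ⟨h, -⟩
      obtain ⟨j, hj⟩ := f.surjective ⟨v, h⟩
      exact ⟨j, congrArg Subtype.val hj⟩

theorem mainTheorem4 {V : Type*} [Finite V] (G : SimpleGraph V) (hG : IsMaximalPlanar G)
    (a b : V) (hab : a ≠ b) (halike : Alike G a b) :
    ∃ n : ℕ, 3 ≤ n ∧ ∃ φ : bipyramid n ≃g G,
      φ (Sum.inl 0) = a ∧ φ (Sum.inl 1) = b ∧
      Set.range (fun j : Fin n => φ (Sum.inr j)) = G.commonNeighbors a b := by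
  obtain ⟨D, hD⟩ := hG
  obtain ⟨x₀, y₀, hax₀, hxy₀, hya₀⟩ := PlaneDrawing.exists_triangle_of_vertex hD a
  let H : SimpleGraph {v | G.Adj a v} := G.induce {v | G.Adj a v}
  have hcover : ∀ x : {v | G.Adj a v}, ∀ y, H.Adj x y →
      ∀ v, v = a ∨ v = b ∨ ∃ h : G.Adj a v, H.Reachable x ⟨v, h⟩ := by
    intro x y hxy v
    refine PlaneDrawing.eq_or_eq_or_mem_of_closed hD hab halike
      (C := {v | ∃ h : G.Adj a v, H.Reachable x ⟨v, h⟩}) ?_ ?_ (x₀ := x) (y₀ := y) ?_ ?_ hxy v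
    · rintro u ⟨h, _⟩
      exact h
    · rintro u ⟨h, hu⟩ t hat hut
      exact ⟨hat, hu.trans (SimpleGraph.Adj.reachable (G := H) (u := ⟨u, h⟩) (v := ⟨t, hat⟩) hut)⟩
    · exact ⟨x.2, SimpleGraph.Reachable.refl _⟩
    · exact ⟨y.2, hxy.reachable⟩
  let x : {v | G.Adj a v} := ⟨x₀, hax₀⟩
  let y : {v | G.Adj a v} := ⟨y₀, hya₀.symm⟩
  have hxy : H.Adj x y := hxy₀
  have hreach : ∀ u, H.Reachable x u := fun u => by
    rcases hcover x y hxy u with h | h | ⟨_, h⟩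
    · exact absurd u.2 (by rw [h]; exact G.irrefl)
    · exact absurd ((Set.ext_iff.1 halike u).1 u.2) (by rw [h]; exact G.irrefl)
    · exact h
  have hconn : H.Preconnected := fun u v => (hreach u).symm.trans (hreach v)
  have hcyc : H.IsCycles := by
    rintro u ⟨t, hut⟩
    have := PlaneDrawing.ncard_adj_eq_two hD hab halike u.2 hut t.2.symm
    rw [← this, ← Set.ncard_image_of_injective _ Subtype.val_injective]
    congr 1
    ext s
    constructor
    · rintro ⟨s, hs, rfl⟩
      exact ⟨hs, s.2⟩
    · rintro ⟨hs, has⟩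
      exact ⟨⟨s, has⟩, hs, rfl⟩
  obtain ⟨n, hn, ⟨f⟩⟩ := hcyc.exists_iso_cycleGraph hconn hxy
  refine ⟨n, hn, exists_bipyramid_iso hab halike (fun v => ?_) f⟩
  rcases hcover x y hxy v with h | h | ⟨h, _⟩
  exacts [Or.inl h, Or.inr (Or.inl h), Or.inr (Or.inr h)]
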